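/- Let $p$ be a prime, $a\ge 1$, $q=p^a$. For $i\ge 0$ let $f_i(x)=\sum_u a_{iu}x^u\in\mathbb{F}_q[x]$ be a polynomial of degree $d_i$ (with $d_i=0$ if $f_i$ is constant or zero), and assume that $d_0>0$ and that the sequence $(d_i)_{i\ge 0}$ is bounded. Write $\mathbb{Z}_{p^r}=W(\mathbb{F}_{p^r})$ for the ring of integers of the unramified extension $\mathbb{Q}_{p^r}$ of $\mathbb{Q}_p$ of degree $r$, let $\hat{\ }$ denote the Teichmüller lift, and put $$\hat f(x)=\sum_{i\ge 0}p^i\sum_{u}\widehat{a_{iu}}\,x^u\in\mathbb{Z}_q[x].$$ For $k\ge 1$ let $\mu_{q^k-1}\subset\mathbb{Z}_{q^k}$ be the group of $(q^k-1)$-th roots of unity, and define $$S_f(T,k)=\sum_{x\in\mu_{q^k-1}}(1+T)^{\mathrm{Tr}_{\mathbb{Q}_{q^k}/\mathbb{Q}_p}(\hat f(x))}\in\mathbb{Z}_p[[T]],\qquad (1+T)^z=\sum_{j\ge 0}\binom{z}{j}T^j\ \ (z\in\mathbb{Z}_p),$$ $$C_f(T,s)=\exp\Big(-\sum_{k\ge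 1}\frac{1}{q^k-1}S_f(T,k)\frac{s^k}{k}\Big)\in\mathbb{Q}_p[[T]][[s]].$$ Let $\delta=\max_{i\ge 0} d_i/p^i$, and let $\widetilde m$ be one plus the first index $i$ with $d_i=\max_{j\ge 0}d_j$. If $\widetilde m=1$, let $\mathrm{ord}_R$ be the $T$-adic order on $\mathbb{Z}_p[[T]]$. If $\widetilde m\ge 2$, put $\theta=\frac{1}{p^{\widetilde m-2}(p-1)}$ and let $\mathrm{ord}_R(b)$, for $b\in\mathbb{Z}_p[[T]]$, be the $(p^\theta,T)$-adic order of $b$, that is, the supremum of all integers $m\ge 0$ such that $b$ lies in the $m$-th power of the ideal $(p^\theta,T)$ of $\mathbb{Z}_p[p^\theta][[T]]$. Then $C_f(T,s)=\sum_{n\ge 0}b_{f,n}(T)s^n$ with $b_{f,n}(T)\in\mathbb{Z}_p[[T]]$, and for every $n\ge 0$ $$\mathrm{ord}_R(b_{f,n}(T))\ \ge\ \frac{a(p-1)n(n-1)}{2\delta}.$$ -/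

import Mathlib

open scoped ENNReal PowerSeries

noncomputable section

namespace WittTower

/-- The Witt vector `(c₀, c₁ ^ p, c₂ ^ p², …)`, which over a perfect ring of characteristic `p` is
the `p`-adically convergent series `∑ i, p ^ i * [c i]` of Teichmüller representatives; see
`pow_dvd_teichmullerSeries_sub_sum`. -/
def teichmullerSeries (p : ℕ) [Fact p.Prime] {K : Type*} [CommRing K] (c : ℕ → K) :
    WittVector p K :=
  WittVector.mk p fun i => c i ^ p ^ i

/-- `teichmullerSeries p c` is the `p`-adic limit of the partial sums of `∑ i, p ^ i * [c i]`. -/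
theorem pow_dvd_teichmullerSeries_sub_sum (p : ℕ) [Fact p.Prime] {K : Type*} [CommRing K]
    [CharP K p] [PerfectRing K p] (c : ℕ → K) (m : ℕ) :
    (p : WittVector p K) ^ m ∣ teichmullerSeries p c -
      ∑ i ∈ Finset.range m, (p : WittVector p K) ^ i * WittVector.teichmuller p (c i) := by
  rcases m with _ | n
  · simp
  · have h := WittVector.dvd_sub_sum_teichmuller_iterateFrobeniusEquiv_coeff
      (teichmullerSeries p c) n
    convert h using 2
    rw [Nat.range_succ_eq_Iic]
    refine Finset.sum_congr rfl fun i _ => ?_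
    rw [mul_comm]
    congr 2
    have h2 : ∀ (j : ℕ) (y : K), ((frobeniusEquiv K p).symm ^ j) (y ^ p ^ j) = y := by
      intro j
      induction j with
      | zero => intro y; simp
      | succ j ih =>
        intro y
        rw [pow_succ', RingAut.mul_apply, pow_succ p j, mul_comm, pow_mul, ih,
          RingEquiv.symm_apply_eq, frobeniusEquiv_apply, frobenius_def]
    exact (h2 i (c i)).symm

/-- `D = max d_i`, where `d_i` is the degree of `f_i` (and `d_i = 0` for a constant `f_i`). -/
def maxDegree {F : Type*} [Field F] (f : ℕ → Polynomial F) : ℕ :=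
  ⨆ i, (f i).natDegree

/-- `δ = max (d_i / p ^ i)`. -/
def delta (p : ℕ) {F : Type*} [Field F] (f : ℕ → Polynomial F) : ℝ :=
  ⨆ i : ℕ, ((f i).natDegree : ℝ) / (p : ℝ) ^ i

/-- One plus the first index `i` with `d_i = D`. -/
def mTilde {F : Type*} [Field F] (f : ℕ → Polynomial F) : ℕ :=
  1 + sInf {i | (f i).natDegree = maxDegree f}

/-- The polynomial `∑ i, p ^ i * f̂_i` over `ℤ_q = W(F)`, where `f̂_i` is obtained from `f_i` by
taking the Teichmüller representative of every coefficient. -/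
def fHat (p : ℕ) [Fact p.Prime] {F : Type*} [Field F] (f : ℕ → Polynomial F) :
    Polynomial (WittVector p F) :=
  ∑ u ∈ Finset.range (maxDegree f + 1),
    Polynomial.monomial u (teichmullerSeries p fun i => (f i).coeff u)

/-- The ring homomorphism `ℤ_p = W(𝔽_p) → W(K)` for a field `K` of characteristic `p`. -/
def padicIntToWitt (p : ℕ) [Fact p.Prime] (K : Type*) [Field K] [CharP K p] :
    ℤ_[p] →+* WittVector p K :=
  (WittVector.map (ZMod.castHom (dvd_refl p) K)).comp
    (WittVector.equiv p).symm.toRingHom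

/-- The trace from `W(K)` to `ℤ_p`; for `K` finite this is the restriction to the integers of the
trace of the unramified extension of `ℚ_p` with residue field `K`. -/
def wittTrace (p : ℕ) [Fact p.Prime] (K : Type*) [Field K] [CharP K p] (z : WittVector p K) :
    ℤ_[p] :=
  letI : Algebra ℤ_[p] (WittVector p K) := (padicIntToWitt p K).toAlgebra
  Algebra.trace ℤ_[p] (WittVector p K) z

instance charP_extension (p : ℕ) [Fact p.Prime] (F : Type*) [Field F] [Finite F] [CharP F p]
    (k : ℕ) [NeZero k] : CharP (FiniteField.Extension F p k) p :=
  charP_of_injective_algebraMap (algebraMap F (FiniteField.Extension F p k)).injective p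

/-- The `T`-adic exponential sum
`S_f(T, k) = ∑_{x ∈ μ_{q ^ k - 1}} (1 + T) ^ Tr(f̂(x))`, where `x` runs over the `(q ^ k - 1)`-th
roots of unity in `ℤ_{q ^ k} = W(𝔽_{q ^ k})`, the trace goes down to `ℤ_p`, and `q = #F`. -/
def expSum (p : ℕ) [Fact p.Prime] {F : Type*} [Field F] [Finite F] [CharP F p]
    (f : ℕ → Polynomial F) (k : ℕ) [NeZero k] : ℤ_[p]⟦X⟧ :=
  ∑ x ∈ Polynomial.nthRootsFinset (Nat.card F ^ k - 1)
      (1 : WittVector p (FiniteField.Extension F p k)),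
    PowerSeries.binomialSeries ℤ_[p]
      (wittTrace p (FiniteField.Extension F p k)
        ((fHat p f).eval₂ (WittVector.map (algebraMap F (FiniteField.Extension F p k))) x))

/-- The exponent `- ∑_{k ≥ 1} (q ^ k - 1)⁻¹ S_f(T, k) s ^ k / k`, a power series in `s` over
`ℚ_p⟦T⟧`. -/
def logCharSeries (p : ℕ) [Fact p.Prime] {F : Type*} [Field F] [Finite F] [CharP F p]
    (f : ℕ → Polynomial F) : ℚ_[p]⟦X⟧⟦X⟧ :=
  PowerSeries.mk fun
    | 0 => 0
    | k + 1 => -((((Nat.card F : ℚ_[p]) ^ (k + 1) - 1) * ((k + 1 : ℕ) : ℚ_[p]))⁻¹ •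
        PowerSeries.map (algebraMap ℤ_[p] ℚ_[p]) (expSum p f (k + 1)))

/-- `C_f(T, s) = exp (- ∑_{k ≥ 1} (q ^ k - 1)⁻¹ S_f(T, k) s ^ k / k)`; the outer power series
variable is `s`, the inner one is `T`. -/
def charSeries (p : ℕ) [Fact p.Prime] {F : Type*} [Field F] [Finite F] [CharP F p]
    (f : ℕ → Polynomial F) : ℚ_[p]⟦X⟧⟦X⟧ :=
  (PowerSeries.exp ℚ).subst (logCharSeries p f)

/-- The `I`-adic order of `x`: the supremum of all `m` with `x ∈ I ^ m`. -/
def adicOrder {A : Type*} [CommRing A] (I : Ideal A) (x : A) : ℕ∞ :=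
  ⨆ (m : ℕ) (_ : x ∈ I ^ m), (m : ℕ∞)

/-- For `θ = 1 / N`, the ring `ℤ_p[p ^ θ] = ℤ_p[Y] / (Y ^ N - p)`. -/
abbrev PadicIntRoot (p : ℕ) [Fact p.Prime] (N : ℕ) : Type :=
  AdjoinRoot (Polynomial.X ^ N - Polynomial.C (p : ℤ_[p]))

/-- The `R`-order on `ℤ_p⟦T⟧` belonging to the level `m = m̃ ≥ 1`. For `m = 1` it is the `T`-adic
order. For `m ≥ 2` put `θ = 1 / (p ^ (m - 2) * (p - 1))`; then it is the order with respect to the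
ideal `(p ^ θ, T)` of `ℤ_p[p ^ θ]⟦T⟧`. -/
def ordR (p : ℕ) [Fact p.Prime] (m : ℕ) (b : ℤ_[p]⟦X⟧) : ℕ∞ :=
  if m = 1 then adicOrder (Ideal.span {(PowerSeries.X : ℤ_[p]⟦X⟧)}) b
  else
    adicOrder
      (Ideal.span {PowerSeries.C (AdjoinRoot.root
          (Polynomial.X ^ (p ^ (m - 2) * (p - 1)) - Polynomial.C (p : ℤ_[p]))),
        (PowerSeries.X : (PadicIntRoot p (p ^ (m - 2) * (p - 1)))⟦X⟧)})
      (PowerSeries.map (algebraMap ℤ_[p] (PadicIntRoot p (p ^ (m - 2) * (p - 1)))) b)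

end WittTower

end

/-!
Dwork's splitting function, the product of Artin-Hasse exponentials with logarithm
`∑_{m ≥ 1} x ^ (p ^ v_p(m)) t ^ m / m`, has coefficients in `ℤ_p[x]`. Substituting
`t = 1 - (1 + T) ^ (-p ^ i)` and multiplying over the terms of a partial sum of `f̂` produces a
power series in `T` whose values at the Teichmüller points, multiplied over the Frobenius
conjugates, are `(1 + T) ^ Tr f̂(x)`. Hence, modulo any power of `T`, the exponential sums are
`q ^ k - 1` times the traces of the powers of a matrix `B` over `W(F)⟦T⟧`, a product of `a` matrices
of Dwork's operator `ψ_p`, and by Newton's identities `C_f` is congruent to `det (1 - s B)`.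

The entries of the `a` factors in row `u` and column `v` have order at least `(p u - v) / δ`.
Expanding a minor of their product over the intermediate indices, the weights telescope, and an
`n × n` principal minor of `B` has order at least `a (p - 1) (0 + 1 + ⋯ + (n - 1)) / δ`, which is
the bound. The coefficients of `C_f` thus lie both in `ℚ_p` and in `W(F)`, hence in `ℤ_p`, and the
bound passes to the limit over the partial sums of `f̂`.
-/

namespace WittTower

open PowerSeries

section LogDeriv

open Finset.HasAntidiagonal (antidiagonal mem_antidiagonal)

variable {R S : Type*} [CommRing R] [CommRing S]

/-- `l` is a logarithmic derivative of the power series `g`. The relation is written `g' = l g`, so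
that `g` need not be invertible. -/
def HasLogDeriv (g l : R⟦X⟧) : Prop :=
  d⁄dX R g = l * g

theorem derivative_map (φ : R →+* S) (g : R⟦X⟧) : d⁄dX S (map φ g) = map φ (d⁄dX R g) := by
  ext n
  simp [coeff_derivative]

namespace HasLogDeriv

variable {g h l m : R⟦X⟧}

theorem one : HasLogDeriv (1 : R⟦X⟧) 0 := by
  simp [HasLogDeriv]

theorem mul (hg : HasLogDeriv g l) (hh : HasLogDeriv h m) : HasLogDeriv (g * h) (l + m) := by
  rw [HasLogDeriv] at hg hh ⊢
  rw [Derivation.leibniz, hg, hh, smul_eq_mul, smul_eq_mul]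
  ring

theorem prod {ι : Type*} (s : Finset ι) {g l : ι → R⟦X⟧} (h : ∀ i ∈ s, HasLogDeriv (g i) (l i)) :
    HasLogDeriv (∏ i ∈ s, g i) (∑ i ∈ s, l i) := by
  classical
  induction s using Finset.induction_on with
  | empty => simpa using one
  | insert a s ha ih =>
    rw [Finset.prod_insert ha, Finset.sum_insert ha]
    exact (h a (Finset.mem_insert_self _ _)).mul (ih fun i hi => h i (Finset.mem_insert_of_mem hi))

theorem pow (hg : HasLogDeriv g l) (n : ℕ) : HasLogDeriv (g ^ n) (n * l) := by
  simpa using prod (Finset.range n) fun _ _ => hg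

theorem map (hg : HasLogDeriv g l) (φ : R →+* S) :
    HasLogDeriv (PowerSeries.map φ g) (PowerSeries.map φ l) := by
  rw [HasLogDeriv, derivative_map, hg, map_mul]

theorem subst (hg : HasLogDeriv g l) {c : R⟦X⟧} (hc : HasSubst c) :
    HasLogDeriv (g.subst c) (l.subst c * d⁄dX R c) := by
  rw [HasLogDeriv, derivative_subst hc, hg, ← coe_substAlgHom hc, map_mul]
  ring

theorem exp_subst [Algebra ℚ R] {c : R⟦X⟧} (hc : HasSubst c) :
    HasLogDeriv ((exp R).subst c) (d⁄dX R c) := by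
  rw [HasLogDeriv, derivative_subst hc, derivative_exp, mul_comm]

theorem succ_mul_coeff (hg : HasLogDeriv g l) (n : ℕ) :
    ((n + 1 : ℕ) : R) * coeff (n + 1) g =
      ∑ ij ∈ antidiagonal n, coeff ij.1 l * coeff ij.2 g := by
  have h := congrArg (coeff n) hg
  rw [coeff_derivative, coeff_mul] at h
  rw [← h, Nat.cast_succ, mul_comm]

theorem eq_of_constantCoeff_eq [IsAddTorsionFree R] (hg : HasLogDeriv g l) (hh : HasLogDeriv h l)
    (h0 : constantCoeff g = constantCoeff h) : g = h := by
  ext n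
  induction n using Nat.strong_induction_on with
  | _ n ih =>
    rcases n with _ | n
    · simpa using h0
    · refine nsmul_right_injective n.succ_ne_zero ?_
      simp only [nsmul_eq_mul]
      rw [hg.succ_mul_coeff, hh.succ_mul_coeff]
      refine Finset.sum_congr rfl fun ij hij => ?_
      rw [ih ij.2 (Nat.lt_succ_of_le (Finset.HasAntidiagonal.antidiagonal.snd_le hij))]

/-- Pass to the quotient by `I`, where the two series have the same logarithmic derivative. -/
theorem coeff_sub_mem [Algebra ℚ R] {I : Ideal R} (hg : HasLogDeriv g l) (hh : HasLogDeriv h m)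
    (h0 : constantCoeff g = constantCoeff h) (hlm : ∀ n, coeff n l - coeff n m ∈ I) (n : ℕ) :
    coeff n g - coeff n h ∈ I := by
  have : IsAddTorsionFree (R ⧸ I) := .of_module_rat _
  have hl : PowerSeries.map (Ideal.Quotient.mk I) l = PowerSeries.map (Ideal.Quotient.mk I) m := by
    ext n
    simpa using Ideal.Quotient.eq.2 (hlm n)
  have hgh := (hg.map (Ideal.Quotient.mk I)).eq_of_constantCoeff_eq (hl ▸ hh.map _) <| by
    simp only [← coeff_zero_eq_constantCoeff_apply, coeff_map] at h0 ⊢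
    rw [h0]
  refine Ideal.Quotient.eq.1 ?_
  simpa using congrArg (coeff n) hgh

theorem tendsto_coeff [TopologicalSpace R] [IsTopologicalRing R] [Algebra ℚ R] {ι : Type*}
    {u : Filter ι} {g' l' : ι → R⟦X⟧} (hg : HasLogDeriv g l) (hg' : ∀ i, HasLogDeriv (g' i) (l' i))
    (h0 : ∀ i, constantCoeff (g' i) = constantCoeff g)
    (hl : ∀ n, Filter.Tendsto (fun i => coeff n (l' i)) u (nhds (coeff n l))) (n : ℕ) :
    Filter.Tendsto (fun i => coeff n (g' i)) u (nhds (coeff n g)) := by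
  induction n using Nat.strong_induction_on with
  | _ n ih =>
    rcases n with _ | n
    · simpa [h0] using tendsto_const_nhds
    · have hinv : algebraMap ℚ R (n + 1 : ℚ)⁻¹ * ((n + 1 : ℕ) : R) = 1 := by
        rw [← map_natCast (algebraMap ℚ R), ← map_mul, Nat.cast_succ,
          inv_mul_cancel₀ n.cast_add_one_ne_zero, map_one]
      have hrec {f k : R⟦X⟧} (hf : HasLogDeriv f k) : coeff (n + 1) f =
          algebraMap ℚ R (n + 1 : ℚ)⁻¹ *
            ∑ ij ∈ antidiagonal n, coeff ij.1 k * coeff ij.2 f := by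
        rw [← hf.succ_mul_coeff, ← mul_assoc, hinv, one_mul]
      simp only [hrec hg, fun i => hrec (hg' i)]
      refine (tendsto_finsetSum _ fun ij hij => (hl _).mul (ih ij.2 ?_)).const_mul _
      exact Nat.lt_succ_of_le (Finset.HasAntidiagonal.antidiagonal.snd_le hij)

open Polynomial in
theorem natDegree_coeff_le [IsDomain R] [CharZero R] {g l : R[X]⟦X⟧} (hg : HasLogDeriv g l)
    (h0 : (constantCoeff g).natDegree = 0) (hl : ∀ n, (coeff n l).natDegree ≤ n + 1) (n : ℕ) :
    (coeff n g).natDegree ≤ n := by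
  induction n using Nat.strong_induction_on with
  | _ n ih =>
    rcases n with _ | n
    · simp [h0]
    · rw [← natDegree_C_mul (a := ((n + 1 : ℕ) : R)) (by exact_mod_cast n.succ_ne_zero),
        map_natCast, hg.succ_mul_coeff]
      refine natDegree_sum_le_of_forall_le _ _ fun ij hij => natDegree_mul_le.trans ?_
      have hn := mem_antidiagonal.1 hij
      have := hl ij.1
      have := ih ij.2 (by omega)
      omega

end HasLogDeriv

theorem exists_constantCoeff_eq_zero_derivative_eq [Algebra ℚ R] (l : R⟦X⟧) :
    ∃ L : R⟦X⟧, constantCoeff L = 0 ∧ d⁄dX R L = l := by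
  refine ⟨mk fun n => algebraMap ℚ R (n : ℚ)⁻¹ * coeff (n - 1) l, by simp, ?_⟩
  ext n
  have hinv : algebraMap ℚ R ((n + 1 : ℕ) : ℚ)⁻¹ * ((n : R) + 1) = 1 := by
    rw [← Nat.cast_succ, ← map_natCast (algebraMap ℚ R), ← map_mul,
      inv_mul_cancel₀ (by positivity), map_one]
  rw [coeff_derivative, coeff_mk, Nat.add_sub_cancel]
  linear_combination coeff n l * hinv

theorem constantCoeff_subst_of_constantCoeff_eq_zero {c : R⟦X⟧} (hc : constantCoeff c = 0)
    (g : R⟦X⟧) : constantCoeff (g.subst c) = constantCoeff g := by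
  have hs : HasSubst c := .of_constantCoeff_zero' hc
  rw [← coeff_zero_eq_constantCoeff_apply, coeff_subst' hs, finsum_eq_single _ 0]
  · simp
  · intro n hn
    simp [hc, hn]

theorem exists_hasLogDeriv [Algebra ℚ R] (l : R⟦X⟧) :
    ∃ g : R⟦X⟧, constantCoeff g = 1 ∧ HasLogDeriv g l := by
  obtain ⟨L, hL, rfl⟩ := exists_constantCoeff_eq_zero_derivative_eq l
  refine ⟨(exp R).subst L, ?_, .exp_subst (.of_constantCoeff_zero' hL)⟩
  rw [constantCoeff_subst_of_constantCoeff_eq_zero hL, constantCoeff_exp]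

end LogDeriv

section Dwork

variable {p : ℕ} [hp : Fact p.Prime] {A B : Type*} [CommRing A] [CommRing B]

/-- The extension `∑ aₙ tⁿ ↦ ∑ φ(aₙ) t^(pn)` of an endomorphism `φ` of `A` to `A⟦t⟧`, which lifts
the Frobenius of `(A/p)⟦t⟧` if `φ` lifts the Frobenius of `A/p`. -/
noncomputable def frobeniusLift (p : ℕ) [hp : Fact p.Prime] (φ : A →+* A) : A⟦X⟧ →+* A⟦X⟧ :=
  (expand p hp.out.ne_zero).toRingHom.comp (map φ)

theorem coeff_frobeniusLift (φ : A →+* A) (g : A⟦X⟧) (n : ℕ) :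
    coeff n (frobeniusLift p φ g) = if p ∣ n then φ (coeff (n / p) g) else 0 := by
  simp [frobeniusLift, coeff_expand]

theorem constantCoeff_frobeniusLift (φ : A →+* A) (g : A⟦X⟧) :
    constantCoeff (frobeniusLift p φ g) = φ (constantCoeff g) := by
  simp only [← coeff_zero_eq_constantCoeff_apply, coeff_frobeniusLift, dvd_zero, if_true,
    Nat.zero_div]

theorem map_frobeniusLift (ι : A →+* B) {φ : A →+* A} {ψ : B →+* B}
    (h : ∀ a, ι (φ a) = ψ (ι a)) (g : A⟦X⟧) :
    map ι (frobeniusLift p φ g) = frobeniusLift p ψ (map ι g) := by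
  ext n
  rw [coeff_map, coeff_frobeniusLift, coeff_frobeniusLift, coeff_map, apply_ite ι, h, map_zero]

theorem frobeniusLift_frobenius [ExpChar A p] (g : A⟦X⟧) :
    frobeniusLift p (frobenius A p) g = g ^ p := by
  refine Eq.trans ?_ (MvPowerSeries.map_frobenius_expand p hp.out.ne_zero (f := g))
  exact (map_expand p hp.out.ne_zero (frobenius A p) g).symm

theorem hasLogDeriv_frobeniusLift {g l : A⟦X⟧} (hg : HasLogDeriv g l) (φ : A →+* A) :
    HasLogDeriv (frobeniusLift p φ g) ((p : A⟦X⟧) * (X ^ (p - 1) * frobeniusLift p φ l)) := by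
  have hsubst (g : A⟦X⟧) : frobeniusLift p φ g = (map φ g).subst (X ^ p : A⟦X⟧) := by
    rw [← expand_apply p hp.out.ne_zero]
    rfl
  have h := (hg.map φ).subst (HasSubst.X_pow hp.out.ne_zero)
  rw [derivative_pow, derivative_X, ← hsubst, ← hsubst] at h
  convert h using 1
  ring

theorem dvd_coeff_frobeniusLift_sub_pow {φ : A →+* A} (hφ : ∀ a, (p : A) ∣ φ a - a ^ p) (g : A⟦X⟧)
    (n : ℕ) : (p : A) ∣ coeff n (frobeniusLift p φ g - g ^ p) := by
  by_cases hu : IsUnit (p : A)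
  · exact hu.dvd
  let π := Ideal.Quotient.mk (Ideal.span {(p : A)})
  have hπ (a : A) : π a = 0 ↔ (p : A) ∣ a := by
    rw [Ideal.Quotient.eq_zero_iff_mem, Ideal.mem_span_singleton]
  have : CharP (A ⧸ Ideal.span {(p : A)}) p := .quotient A p hu
  have : ExpChar (A ⧸ Ideal.span {(p : A)}) p := .prime hp.out
  have hfrob (a : A) : π (φ a) = frobenius _ p (π a) := by
    rw [frobenius_def, ← map_pow, ← sub_eq_zero, ← map_sub, hπ]
    exact hφ a
  rw [← hπ, ← coeff_map, map_sub, map_frobeniusLift π hfrob, frobeniusLift_frobenius, map_pow,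
    sub_self, map_zero]

theorem coeff_pow_mul_eq_add {G P U : B⟦X⟧} {n : ℕ} (hn : n ≠ 0)
    (hGP : ∀ m < n, coeff m G = coeff m P) (hP : constantCoeff P = 1) (hU : constantCoeff U = 1)
    (k : ℕ) :
    coeff n (G ^ k * U) = coeff n (P ^ k * U) + k * (coeff n G - coeff n P) := by
  obtain ⟨H, hH⟩ : X ^ n ∣ G - P := X_pow_dvd_iff.2 fun m hm => by rw [map_sub, hGP m hm, sub_self]
  have hG : constantCoeff G = 1 := by
    simpa [hP] using hGP 0 (Nat.pos_of_ne_zero hn)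
  have hcoeff (V : B⟦X⟧) : coeff n (X ^ n * V) = constantCoeff V := by
    simpa using coeff_X_pow_mul V n 0
  have hpow : G ^ k * U = P ^ k * U +
      X ^ n * ((∑ i ∈ Finset.range k, G ^ i * P ^ (k - 1 - i)) * H * U) := by
    linear_combination U * (∑ i ∈ Finset.range k, G ^ i * P ^ (k - 1 - i)) * hH -
      U * geom_sum₂_mul G P k
  rw [hpow, ← map_sub, hH, map_add, hcoeff, hcoeff]
  simp [hG, hP, hU]

/-- Comparing the coefficients of `tⁿ` in the functional equation expresses `p · coeff n G` through
an integral truncation of `G`, and the result is divisible by `p` (Dwork). -/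
theorem coeff_mem_range_of_frobeniusLift_eq [IsAddTorsionFree B] (ι : A →+* B)
    {φ : A →+* A} (hφ : ∀ a, (p : A) ∣ φ a - a ^ p) {ψ : B →+* B} (hψ : ∀ a, ι (φ a) = ψ (ι a))
    {G : B⟦X⟧} {V : A⟦X⟧} (hG0 : constantCoeff G = 1) (hV0 : constantCoeff V = 0)
    (hG : frobeniusLift p ψ G = G ^ p * map ι (1 + C (p : A) * V)) (n : ℕ) :
    coeff n G ∈ ι.range := by
  induction n using Nat.strong_induction_on with
  | _ n ih =>
    rcases eq_or_ne n 0 with rfl | hn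
    · exact ⟨1, by simp [hG0]⟩
    choose! c hc using ih
    let P : A⟦X⟧ := mk fun m => if m = 0 then 1 else if m < n then c m else 0
    have hP : ∀ m < n, coeff m G = coeff m (map ι P) := by
      intro m hm
      rcases eq_or_ne m 0 with rfl | hm0
      · simp [P, hG0]
      · simp [P, hm0, hm, hc m hm]
    have hGP := coeff_pow_mul_eq_add hn hP (U := map ι (1 + C (p : A) * V))
      (by simp [P, ← coeff_zero_eq_constantCoeff_apply])
      (by rw [← coeff_zero_eq_constantCoeff_apply, coeff_map]; simp [hV0]) p
    have hfrob : coeff n (frobeniusLift p ψ G) = ι (coeff n (frobeniusLift p φ P)) := by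
      rw [coeff_frobeniusLift, coeff_frobeniusLift, apply_ite ι, map_zero, hψ,
        hP _ (Nat.div_lt_self (Nat.pos_of_ne_zero hn) hp.out.one_lt), coeff_map]
    obtain ⟨r, hr⟩ : (p : A) ∣ coeff n (frobeniusLift p φ P - P ^ p * (1 + C (p : A) * V)) := by
      have hsplit : frobeniusLift p φ P - P ^ p * (1 + C (p : A) * V) =
          frobeniusLift p φ P - P ^ p - C (p : A) * (P ^ p * V) := by ring
      rw [hsplit, map_sub, coeff_C_mul]
      exact dvd_sub (dvd_coeff_frobeniusLift_sub_pow hφ P n) (dvd_mul_right _ _)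
    refine ⟨r, nsmul_right_injective hp.out.ne_zero ?_⟩
    have hPn : coeff n (map ι P) = 0 := by simp [P, hn]
    rw [← hG, hfrob, ← map_pow, ← map_mul, coeff_map, hPn, sub_zero] at hGP
    have hpr := congrArg ι hr
    rw [map_sub, map_sub, hGP, add_sub_cancel_left, map_mul, map_natCast] at hpr
    simpa only [nsmul_eq_mul] using hpr.symm

end Dwork

section SplittingFunction

open scoped Polynomial

variable {p : ℕ} {A B : Type*} [CommRing A] [CommRing B]

/-- The logarithmic derivative `∑ n, x ^ (p ^ v_p(n + 1)) t ^ n` of the splitting function. Its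
antiderivative is `∑ λ(k, i) x ^ (p ^ i) t ^ (k p ^ i)`, with `λ(k, i) = 1 / (k p ^ i)` and `k`
prime to `p`. -/
noncomputable def splittingLogDeriv (p : ℕ) (x : A) : A⟦X⟧ :=
  mk fun n => x ^ p ^ padicValNat p (n + 1)

theorem map_splittingLogDeriv (φ : A →+* B) (x : A) :
    map φ (splittingLogDeriv p x) = splittingLogDeriv p (φ x) := by
  ext n
  simp [splittingLogDeriv]

/-- The part `x ∑ t ^ n` of `splittingLogDeriv p x`, over the `n` with `n + 1` prime to `p`. -/
noncomputable def primeToPartLogDeriv (p : ℕ) (x : A) : A⟦X⟧ :=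
  mk fun n => if p ∣ n + 1 then 0 else x

theorem map_primeToPartLogDeriv (φ : A →+* B) (x : A) :
    map φ (primeToPartLogDeriv p x) = primeToPartLogDeriv p (φ x) := by
  ext n
  simp [primeToPartLogDeriv, apply_ite φ]

variable [hp : Fact p.Prime]

theorem X_pow_mul_frobeniusLift_splittingLogDeriv {ψ : A →+* A} {x : A} (hψ : ψ x = x ^ p) :
    X ^ (p - 1) * frobeniusLift p ψ (splittingLogDeriv p x) =
      splittingLogDeriv p x - primeToPartLogDeriv p x := by
  ext n
  have hp1 := hp.out.one_lt
  simp only [coeff_X_pow_mul', map_sub, coeff_frobeniusLift, splittingLogDeriv, primeToPartLogDeriv,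
    coeff_mk]
  by_cases hd : p ∣ n + 1
  · obtain ⟨m, hm⟩ := hd
    obtain ⟨m, rfl⟩ := Nat.exists_eq_succ_of_ne_zero (show m ≠ 0 by rintro rfl; omega)
    have hn : n - (p - 1) = p * m ∧ p - 1 ≤ n := by
      rw [Nat.mul_succ] at hm
      omega
    rw [if_pos hn.2, hn.1, if_pos (dvd_mul_right _ _), Nat.mul_div_cancel_left _ hp.out.pos, hm,
      if_pos (dvd_mul_right _ _), sub_zero, padicValNat.mul hp.out.ne_zero m.succ_ne_zero,
      padicValNat_self, pow_add, pow_one, pow_mul, map_pow, hψ]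
  · have hn : ¬ (p - 1 ≤ n ∧ p ∣ n - (p - 1)) := by
      rintro ⟨hle, c, hc⟩
      exact hd ⟨c + 1, by rw [Nat.mul_succ]; omega⟩
    rw [← ite_and, if_neg hn, if_neg hd, padicValNat.eq_zero_of_not_dvd hd, pow_zero, pow_one,
      sub_self]

theorem frobeniusLift_eq_pow_mul [IsAddTorsionFree A] {ψ : A →+* A} {x : A} (hψ : ψ x = x ^ p)
    {G U : A⟦X⟧} (hG0 : constantCoeff G = 1) (hG : HasLogDeriv G (splittingLogDeriv p x))
    (hU0 : constantCoeff U = 1) (hU : HasLogDeriv U (-(p : A⟦X⟧) * primeToPartLogDeriv p x)) :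
    frobeniusLift p ψ G = G ^ p * U := by
  refine (hasLogDeriv_frobeniusLift hG ψ).eq_of_constantCoeff_eq ?_ ?_
  · convert (hG.pow p).mul hU using 1
    rw [X_pow_mul_frobeniusLift_splittingLogDeriv hψ]
    ring
  · rw [constantCoeff_frobeniusLift, hG0]
    simp [hG0, hU0]

theorem isUnit_natCast_of_not_dvd {n : ℕ} (h : ¬ p ∣ n) : IsUnit (n : ℤ_[p]) := by
  rw [PadicInt.isUnit_iff, PadicInt.norm_natCast_eq_one_iff]
  exact (hp.out.coprime_iff_not_dvd).2 h

theorem exists_factorial_succ_mul_eq_pow (n : ℕ) :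
    ∃ w : ℤ_[p], (n + 1).factorial * w = (p : ℤ_[p]) ^ n := by
  have hv := padicValNat_factorial_lt_of_ne_zero (p := p) n.succ_ne_zero
  obtain ⟨m, hm⟩ := pow_padicValNat_dvd (p := p) (n := (n + 1).factorial)
  have hpm : ¬ p ∣ m := fun ⟨d, hd⟩ =>
    pow_succ_padicValNat_not_dvd (p := p) (Nat.factorial_ne_zero (n + 1))
      ⟨d, by rw [pow_succ, mul_assoc, ← hd, ← hm]⟩
  refine dvd_def.1 ?_ |>.imp fun _ => Eq.symm
  rw [hm, Nat.cast_mul, (isUnit_natCast_of_not_dvd hpm).mul_right_dvd, Nat.cast_pow]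
  exact pow_dvd_pow _ (Nat.lt_succ_iff.1 hv)

/-- The series is `exp (p t)`, whose coefficients `p ^ n / n!` are divisible by `p` for `n ≥ 1`. -/
theorem exists_hasLogDeriv_natCast :
    ∃ E : ℤ_[p]⟦X⟧, constantCoeff E = 0 ∧ HasLogDeriv (1 + C (p : ℤ_[p]) * E) (p : ℤ_[p]⟦X⟧) := by
  choose w hw using exists_factorial_succ_mul_eq_pow (p := p)
  let E : ℤ_[p]⟦X⟧ := mk fun n => n.casesOn 0 w
  have hcoeff (n : ℕ) : n.factorial * coeff n (1 + C (p : ℤ_[p]) * E) = (p : ℤ_[p]) ^ n := by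
    rcases n with _ | n
    · simp [E]
    · rw [map_add, coeff_C_mul, coeff_one, if_neg n.succ_ne_zero, coeff_mk, pow_succ, ← hw n]
      ring
  refine ⟨E, by simp [E], ?_⟩
  ext n
  rw [← map_natCast C p, coeff_C_mul, coeff_derivative]
  refine mul_left_cancel₀ (Nat.cast_ne_zero.2 n.factorial_ne_zero : (n.factorial : ℤ_[p]) ≠ 0) ?_
  have hsucc := hcoeff (n + 1)
  rw [Nat.factorial_succ, Nat.cast_mul, Nat.cast_succ] at hsucc
  linear_combination hsucc - (p : ℤ_[p]) * hcoeff n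

theorem exists_derivative_eq_primeToPartLogDeriv [Algebra ℤ_[p] A] (x : A) :
    ∃ c : A⟦X⟧, constantCoeff c = 0 ∧ d⁄dX A c = primeToPartLogDeriv p x := by
  refine ⟨mk fun n => if p ∣ n then 0 else algebraMap ℤ_[p] A (Ring.inverse (n : ℤ_[p])) * x,
    by simp, ?_⟩
  ext n
  rw [coeff_derivative, coeff_mk, primeToPartLogDeriv, coeff_mk]
  split_ifs with h
  · exact zero_mul _
  · have hinv := congrArg (algebraMap ℤ_[p] A)
      (Ring.inverse_mul_cancel _ (isUnit_natCast_of_not_dvd h))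
    rw [map_mul, map_one, map_natCast] at hinv
    rw [← Nat.cast_succ, mul_right_comm, hinv, one_mul]

/-- The series is `exp (-p x ∑ t ^ n / n)`, the sum being over the `n` prime to `p`. -/
theorem exists_hasLogDeriv_neg_mul_primeToPartLogDeriv [Algebra ℤ_[p] A] (x : A) :
    ∃ V : A⟦X⟧, constantCoeff V = 0 ∧
      HasLogDeriv (1 + C (p : A) * V) (-(p : A⟦X⟧) * primeToPartLogDeriv p x) := by
  obtain ⟨E, hE0, hE⟩ := exists_hasLogDeriv_natCast (p := p)
  obtain ⟨c, hc0, hc⟩ := exists_derivative_eq_primeToPartLogDeriv (p := p) x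
  have hs : HasSubst (-c) := .of_constantCoeff_zero' (by rw [map_neg, hc0, neg_zero])
  refine ⟨(map (algebraMap ℤ_[p] A) E).subst (-c), ?_, ?_⟩
  · rw [constantCoeff_subst_of_constantCoeff_eq_zero (by rw [map_neg, hc0, neg_zero]),
      ← coeff_zero_eq_constantCoeff_apply, coeff_map, coeff_zero_eq_constantCoeff_apply, hE0,
      map_zero]
  · convert (hE.map (algebraMap ℤ_[p] A)).subst hs using 1
    · simp [← coe_substAlgHom hs]
    · simp [← coe_substAlgHom hs, hc]

theorem exists_hasLogDeriv_splittingLogDeriv [Algebra ℤ_[p] A] [Algebra ℚ B] {ι : A →+* B}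
    (hι : Function.Injective ι) {φ : A →+* A} (hφ : ∀ a, (p : A) ∣ φ a - a ^ p) {ψ : B →+* B}
    (hψ : ∀ a, ι (φ a) = ψ (ι a)) {x : A} (hx : φ x = x ^ p) :
    ∃ G : A⟦X⟧, constantCoeff G = 1 ∧ HasLogDeriv G (splittingLogDeriv p x) := by
  have : IsAddTorsionFree B := .of_module_rat B
  obtain ⟨G, hG0, hG⟩ := exists_hasLogDeriv (splittingLogDeriv p (ι x))
  obtain ⟨V, hV0, hV⟩ := exists_hasLogDeriv_neg_mul_primeToPartLogDeriv (p := p) x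
  have hU := hV.map ι
  rw [map_mul, map_neg, map_natCast (map ι), map_primeToPartLogDeriv] at hU
  have hU0 : constantCoeff (map ι (1 + C (p : A) * V)) = 1 := by
    rw [← coeff_zero_eq_constantCoeff_apply, coeff_map]
    simp [hV0]
  have hψx : ψ (ι x) = ι x ^ p := by rw [← hψ, hx, map_pow]
  choose g hg using coeff_mem_range_of_frobeniusLift_eq ι hφ hψ hG0 hV0
    (frobeniusLift_eq_pow_mul hψx hG0 hG hU0 hU)
  have hmap : map ι (mk g) = G := by
    ext1 n
    rw [coeff_map, coeff_mk, hg]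
  refine ⟨mk g, hι ?_, map_injective ι hι ?_⟩
  · rw [← coeff_zero_eq_constantCoeff_apply, coeff_mk, hg, coeff_zero_eq_constantCoeff_apply, hG0,
      map_one]
  · rw [← derivative_map, map_mul, map_splittingLogDeriv, hmap, hG]

theorem natCast_dvd_expand_sub_pow (g : ℤ_[p][X]) :
    (p : ℤ_[p][X]) ∣ Polynomial.expand ℤ_[p] p g - g ^ p := by
  rw [← map_natCast Polynomial.C, Polynomial.C_dvd_iff_dvd_coeff]
  intro i
  rw [← Ideal.mem_span_singleton, ← PadicInt.maximalIdeal_eq_span_p, ← PadicInt.ker_toZMod,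
    RingHom.mem_ker, ← Polynomial.coeff_map, Polynomial.map_sub, Polynomial.map_pow,
    Polynomial.map_expand, ZMod.expand_card, sub_self, Polynomial.coeff_zero]

theorem exists_splittingFunction (p : ℕ) [Fact p.Prime] :
    ∃ G : ℤ_[p][X]⟦X⟧, constantCoeff G = 1 ∧
      HasLogDeriv G (splittingLogDeriv p (Polynomial.X : ℤ_[p][X])) :=
  exists_hasLogDeriv_splittingLogDeriv (ι := Polynomial.mapRingHom (algebraMap ℤ_[p] ℚ_[p]))
    (Polynomial.map_injective _ (IsFractionRing.injective _ _))
    (φ := (Polynomial.expand ℤ_[p] p).toRingHom) natCast_dvd_expand_sub_pow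
    (ψ := (Polynomial.expand ℚ_[p] p).toRingHom) (fun _ => Polynomial.map_expand)
    (Polynomial.expand_X p)

/-- The splitting function `exp (∑_{m ≥ 1} x ^ (p ^ v_p(m)) t ^ m / m)`, a product of Artin–Hasse
exponentials, as a power series in `t` over `ℤ_p[x]`. -/
noncomputable def splittingFunction (p : ℕ) [Fact p.Prime] : ℤ_[p][X]⟦X⟧ :=
  (exists_splittingFunction p).choose

theorem constantCoeff_splittingFunction : constantCoeff (splittingFunction p) = 1 :=
  (exists_splittingFunction p).choose_spec.1

theorem hasLogDeriv_splittingFunction :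
    HasLogDeriv (splittingFunction p) (splittingLogDeriv p Polynomial.X) :=
  (exists_splittingFunction p).choose_spec.2

theorem natDegree_coeff_splittingFunction_le (n : ℕ) :
    (coeff n (splittingFunction p)).natDegree ≤ n := by
  refine hasLogDeriv_splittingFunction.natDegree_coeff_le ?_ (fun m => ?_) n
  · rw [constantCoeff_splittingFunction, Polynomial.natDegree_one]
  · rw [splittingLogDeriv, coeff_mk]
    exact (Polynomial.natDegree_X_pow_le _).trans (Nat.le_of_dvd m.succ_pos pow_padicValNat_dvd)

end SplittingFunction

section NewtonIdeal

open Finset.HasAntidiagonal (antidiagonal mem_antidiagonal)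

theorem ceilDiv_le_ceilDiv_of_le {K L : ℕ} (h : K ≤ L) (N : ℕ) : K ⌈/⌉ N ≤ L ⌈/⌉ N := by
  rcases N.eq_zero_or_pos with rfl | hN
  · simp
  · exact (gc_mul_ceilDiv hN).monotone_l h

theorem add_ceilDiv_le (K L N : ℕ) : (K + L) ⌈/⌉ N ≤ K ⌈/⌉ N + L ⌈/⌉ N := by
  rcases N.eq_zero_or_pos with rfl | hN
  · simp
  · rw [ceilDiv_le_iff_le_mul hN, mul_add]
    exact add_le_add (le_smul_ceilDiv hN) (le_smul_ceilDiv hN)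

variable {A : Type*} [CommRing A] {c N : ℕ}

/-- The ideal of the series `∑ bⱼ T ^ j` with `c ^ ⌈(K - j) / N⌉ ∣ bⱼ` for all `j`: the series of
order at least `K` if `T` has order `1` and `c` has order `N`. For `c = 0` and `N = 1` it is
generated by `T ^ K`. -/
def newtonIdeal (A : Type*) [CommRing A] (c N K : ℕ) : Ideal A⟦X⟧ where
  carrier := {b | ∀ j, (c : A) ^ ((K - j) ⌈/⌉ N) ∣ coeff j b}
  add_mem' ha hb j := by
    rw [map_add]
    exact dvd_add (ha j) (hb j)
  zero_mem' j := by simp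
  smul_mem' a b hb j := by
    rw [smul_eq_mul, coeff_mul]
    refine Finset.dvd_sum fun ij hij => .mul_left ((pow_dvd_pow _ ?_).trans (hb ij.2)) _
    exact ceilDiv_le_ceilDiv_of_le
      (Nat.sub_le_sub_left (Finset.HasAntidiagonal.antidiagonal.snd_le hij) K) N

theorem newtonIdeal_anti {K L : ℕ} (h : K ≤ L) : newtonIdeal A c N L ≤ newtonIdeal A c N K :=
  fun _ hb j =>
    (pow_dvd_pow _ (ceilDiv_le_ceilDiv_of_le (Nat.sub_le_sub_right h j) N)).trans (hb j)

theorem newtonIdeal_zero : newtonIdeal A c N 0 = ⊤ :=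
  (Ideal.eq_top_iff_one _).2 fun j => by simp

theorem mul_mem_newtonIdeal {K L : ℕ} {a b : A⟦X⟧} (ha : a ∈ newtonIdeal A c N K)
    (hb : b ∈ newtonIdeal A c N L) : a * b ∈ newtonIdeal A c N (K + L) := by
  intro j
  rw [coeff_mul]
  refine Finset.dvd_sum fun ij hij => (pow_dvd_pow _ ?_).trans <|
    (pow_add (c : A) _ _).dvd.trans (mul_dvd_mul (ha ij.1) (hb ij.2))
  refine (ceilDiv_le_ceilDiv_of_le ?_ N).trans (add_ceilDiv_le _ _ N)
  have := mem_antidiagonal.1 hij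
  omega

theorem prod_mem_newtonIdeal {ι : Type*} (s : Finset ι) {K : ι → ℕ} {b : ι → A⟦X⟧}
    (hb : ∀ i ∈ s, b i ∈ newtonIdeal A c N (K i)) :
    ∏ i ∈ s, b i ∈ newtonIdeal A c N (∑ i ∈ s, K i) := by
  classical
  induction s using Finset.induction_on with
  | empty => simp [newtonIdeal_zero]
  | insert i s hi ih =>
    rw [Finset.prod_insert hi, Finset.sum_insert hi]
    exact mul_mem_newtonIdeal (hb i (Finset.mem_insert_self _ _))
      (ih fun j hj => hb j (Finset.mem_insert_of_mem hj))

theorem pow_mem_newtonIdeal {K : ℕ} {b : A⟦X⟧} (hb : b ∈ newtonIdeal A c N K) (n : ℕ) :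
    b ^ n ∈ newtonIdeal A c N (K * n) := by
  simpa [mul_comm] using prod_mem_newtonIdeal (Finset.range n) fun _ _ => hb

theorem natCast_mem_newtonIdeal : (c : A⟦X⟧) ∈ newtonIdeal A c N N := by
  intro j
  rw [← map_natCast (C (R := A)), coeff_C]
  split_ifs with h
  · have hN : N ⌈/⌉ N ≤ 1 := by
      rcases N.eq_zero_or_pos with rfl | hN
      · simp
      · rw [ceilDiv_le_iff_le_mul hN, mul_one]
    simpa [h] using pow_dvd_pow (c : A) hN
  · exact dvd_zero _

theorem mem_newtonIdeal_one {b : A⟦X⟧} (hb : constantCoeff b = 0) : b ∈ newtonIdeal A c N 1 := by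
  intro j
  rcases j with _ | j
  · simp [hb]
  · rw [Nat.sub_eq_zero_of_le (Nat.le_add_left 1 j), zero_ceilDiv, pow_zero]
    exact one_dvd _

end NewtonIdeal

section Column

open Finset.HasAntidiagonal (antidiagonal mem_antidiagonal)

open scoped Polynomial

variable {A B : Type*} [CommRing A] [CommRing B] {c N : ℕ}

/-- The coefficient of `x ^ u` in a power series over `A[x]`, as a power series over `A`. -/
noncomputable def column (u : ℕ) (h : A[X]⟦X⟧) : A⟦X⟧ :=
  mk fun j => (coeff j h).coeff u

theorem coeff_column (u j : ℕ) (h : A[X]⟦X⟧) : coeff j (column u h) = (coeff j h).coeff u :=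
  coeff_mk _ _

theorem column_mul (u : ℕ) (g h : A[X]⟦X⟧) :
    column u (g * h) = ∑ vw ∈ antidiagonal u, column vw.1 g * column vw.2 h := by
  ext j
  simp only [coeff_column, coeff_mul, map_sum, Polynomial.finsetSum_coeff, Polynomial.coeff_mul]
  exact Finset.sum_comm

theorem column_succ_one (u : ℕ) : column (u + 1) (1 : A[X]⟦X⟧) = 0 := by
  ext j
  rw [coeff_column, coeff_one]
  split_ifs <;> simp [Polynomial.coeff_one]

/-- The series over `A[x]` in which the coefficient of `x ^ u` has order at least `u / δ`. -/
def weightMonoid (A : Type*) [CommRing A] (c N : ℕ) (δ : ℝ) : Submonoid A[X]⟦X⟧ where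
  carrier := {h | ∀ u : ℕ, column u h ∈ newtonIdeal A c N ⌈(u : ℝ) / δ⌉₊}
  one_mem' u := by
    rcases u with _ | u
    · simp [newtonIdeal_zero]
    · rw [column_succ_one]
      exact zero_mem _
  mul_mem' {g h} hg hh u := by
    rw [column_mul]
    refine sum_mem fun vw hvw => newtonIdeal_anti ?_ (mul_mem_newtonIdeal (hg vw.1) (hh vw.2))
    rw [← mem_antidiagonal.1 hvw, Nat.cast_add, add_div]
    exact Nat.ceil_add_le _ _

theorem map_eval₂_mem_weightMonoid (θ : B →+* A) {δ : ℝ} (hδ : 0 < δ) {e d : ℕ}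
    (hd : (d : ℝ) ≤ δ * e) (α : A) {h : B[X]⟦X⟧}
    (hh : ∀ u, column u h ∈ newtonIdeal B c N (e * u)) :
    map (Polynomial.eval₂RingHom (Polynomial.C.comp θ) (Polynomial.C α * Polynomial.X ^ d)) h ∈
      weightMonoid A c N δ := by
  intro w j
  rw [coeff_column, coeff_map, Polynomial.coe_eval₂RingHom, Polynomial.eval₂_eq_sum,
    Polynomial.sum, Polynomial.finsetSum_coeff]
  refine Finset.dvd_sum fun u _ => ?_
  rw [mul_pow, ← pow_mul, ← Polynomial.C_pow, RingHom.comp_apply, ← mul_assoc, ← Polynomial.C_mul,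
    Polynomial.coeff_C_mul_X_pow]
  split_ifs with hw
  · have hu := map_dvd θ (hh u j)
    rw [map_pow, map_natCast, coeff_column] at hu
    refine ((pow_dvd_pow _ (ceilDiv_le_ceilDiv_of_le (Nat.sub_le_sub_right ?_ _) N)).trans
      hu).mul_right _
    rw [Nat.ceil_le, div_le_iff₀ hδ, hw, Nat.cast_mul, Nat.cast_mul]
    calc (d : ℝ) * u ≤ δ * e * u := by gcongr
      _ = e * u * δ := by ring
  · exact dvd_zero _

theorem column_subst_mem_newtonIdeal {G : A[X]⟦X⟧} (hG : ∀ n, (coeff n G).natDegree ≤ n) {t : A⟦X⟧}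
    (ht : constantCoeff t = 0) {e : ℕ} (hte : t ∈ newtonIdeal A c N e) (u : ℕ) :
    column u (G.subst (map Polynomial.C t)) ∈ newtonIdeal A c N (e * u) := by
  have hs : HasSubst (map Polynomial.C t) := .of_constantCoeff_zero' <| by
    rw [← coeff_zero_eq_constantCoeff_apply, coeff_map, coeff_zero_eq_constantCoeff_apply, ht,
      map_zero]
  intro j
  rw [coeff_column, coeff_subst' hs, finsum_eq_sum _ (coeff_subst_finite' hs G j),
    Polynomial.finsetSum_coeff]
  refine Finset.dvd_sum fun n _ => ?_
  rw [← map_pow, coeff_map, smul_eq_mul, Polynomial.coeff_mul_C]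
  rcases lt_or_ge n u with h | h
  · rw [Polynomial.coeff_eq_zero_of_natDegree_lt ((hG n).trans_lt h), zero_mul]
    exact dvd_zero _
  · exact (newtonIdeal_anti (Nat.mul_le_mul_left e h) (pow_mem_newtonIdeal hte n) j).mul_left _

end Column

section Parameter

variable {R S : Type*} [CommRing R] [CommRing S]

/-- The power series `(1 + T)⁻¹`. -/
noncomputable def invOneAdd (R : Type*) [CommRing R] : R⟦X⟧ :=
  mk fun n => (-1) ^ n

theorem constantCoeff_invOneAdd : constantCoeff (invOneAdd R) = 1 := by
  simp [invOneAdd, ← coeff_zero_eq_constantCoeff_apply]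

theorem map_invOneAdd (φ : R →+* S) : map φ (invOneAdd R) = invOneAdd S := by
  ext n
  simp [invOneAdd]

theorem one_add_X_mul_invOneAdd : (1 + X) * invOneAdd R = 1 := by
  ext n
  rw [add_mul, one_mul, map_add]
  rcases n with _ | n
  · simp [constantCoeff_invOneAdd]
  · rw [coeff_succ_X_mul, coeff_one]
    simp [invOneAdd, pow_succ]

theorem derivative_invOneAdd : d⁄dX R (invOneAdd R) = -invOneAdd R ^ 2 := by
  have h := congrArg (d⁄dX R) (one_add_X_mul_invOneAdd (R := R))
  rw [Derivation.leibniz, map_add, derivative_X, derivative_one] at h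
  simp only [smul_eq_mul, zero_add, mul_one] at h
  linear_combination invOneAdd R * h - d⁄dX R (invOneAdd R) * one_add_X_mul_invOneAdd (R := R)

/-- The parameter `1 - (1 + T) ^ (-p ^ i)`, chosen so that the splitting function turns it into
`(1 + T) ^ (p ^ i y)` when `y` is a Teichmüller representative in `ℤ_p`. -/
noncomputable def levelParam (p : ℕ) (R : Type*) [CommRing R] (i : ℕ) : R⟦X⟧ :=
  1 - invOneAdd R ^ p ^ i

variable {p : ℕ}

theorem constantCoeff_levelParam (i : ℕ) : constantCoeff (levelParam p R i) = 0 := by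
  simp [levelParam, constantCoeff_invOneAdd]

theorem hasSubst_levelParam (i : ℕ) : HasSubst (levelParam p R i) :=
  .of_constantCoeff_zero' (constantCoeff_levelParam i)

theorem map_levelParam (φ : R →+* S) (i : ℕ) : map φ (levelParam p R i) = levelParam p S i := by
  rw [levelParam, levelParam, map_sub, map_one, map_pow, map_invOneAdd]

variable [hp : Fact p.Prime]

theorem derivative_levelParam (i : ℕ) :
    d⁄dX R (levelParam p R i) = (p : R⟦X⟧) ^ i * (invOneAdd R * (1 - levelParam p R i)) := by
  have hpi : p ^ i ≠ 0 := pow_ne_zero _ hp.out.ne_zero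
  rw [levelParam, map_sub, derivative_one, derivative_pow, derivative_invOneAdd, Nat.cast_pow]
  linear_combination (p : R⟦X⟧) ^ i * invOneAdd R * pow_sub_one_mul hpi (invOneAdd R)

theorem exists_levelParam_succ_eq (i : ℕ) :
    ∃ r, levelParam p R (i + 1) = p * (levelParam p R i * r) - (-levelParam p R i) ^ p := by
  obtain ⟨r, hr⟩ := exists_add_pow_prime_eq hp.out (1 : R⟦X⟧) (-levelParam p R i)
  have hsucc : levelParam p R (i + 1) = 1 - (1 + -levelParam p R i) ^ p := by
    rw [levelParam, levelParam, pow_succ, pow_mul]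
    ring
  refine ⟨r, ?_⟩
  rw [hsucc, hr]
  ring

theorem levelParam_mem_newtonIdeal (m i : ℕ) :
    levelParam p R i ∈ newtonIdeal R p (p ^ m * (p - 1)) (p ^ min i (m + 1)) := by
  induction i with
  | zero => simpa using mem_newtonIdeal_one (constantCoeff_levelParam 0)
  | succ i ih =>
    obtain ⟨r, hr⟩ := exists_levelParam_succ_eq (p := p) (R := R) i
    rw [hr]
    refine sub_mem ?_ (newtonIdeal_anti ?_ (pow_mem_newtonIdeal (neg_mem ih) p))
    · rcases le_or_gt i m with him | him
      · refine newtonIdeal_anti ?_ (mul_mem_newtonIdeal natCast_mem_newtonIdeal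
          (Ideal.mul_mem_right r _ ih))
        rw [min_eq_left (by omega), min_eq_left (by omega)]
        calc p ^ (i + 1) = p ^ i * (p - 1) + p ^ i := by
              rw [← Nat.mul_succ, Nat.succ_eq_add_one, Nat.sub_add_cancel hp.out.one_lt.le,
                pow_succ]
          _ ≤ p ^ m * (p - 1) + p ^ i := by
              gcongr
              exact hp.out.pos
      · rw [min_eq_right (by omega)] at ih ⊢
        exact Ideal.mul_mem_left _ _ (Ideal.mul_mem_right r _ ih)
    · rw [← pow_succ]
      exact Nat.pow_le_pow_right hp.out.pos (by omega)

end Parameter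

section LevelSplitting

open scoped Polynomial

variable {p : ℕ} {R S : Type*} [CommRing R] [CommRing S]

theorem sum_pow_pow_pow_eq {r : ℕ} {y : R} (hy : y ^ p ^ r = y) (v : ℕ) :
    ∑ j ∈ Finset.range r, (y ^ p ^ j) ^ p ^ v = ∑ j ∈ Finset.range r, y ^ p ^ j := by
  induction v with
  | zero => simp
  | succ v ih =>
    have hfirst := Finset.sum_range_succ' (fun j => (y ^ p ^ j) ^ p ^ v) r
    have hlast := Finset.sum_range_succ (fun j => (y ^ p ^ j) ^ p ^ v) r
    simp only [hy, pow_zero, pow_one] at hfirst hlast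
    rw [← ih, ← add_right_cancel (hfirst.symm.trans hlast)]
    refine Finset.sum_congr rfl fun j _ => ?_
    rw [← pow_mul, ← pow_mul]
    ring_nf

theorem sum_splittingLogDeriv_pow {r : ℕ} {y : R} (hy : y ^ p ^ r = y) :
    ∑ j ∈ Finset.range r, splittingLogDeriv p (y ^ p ^ j) =
      C (∑ j ∈ Finset.range r, y ^ p ^ j) * mk 1 := by
  ext n
  rw [coeff_C_mul, coeff_mk, Pi.one_apply, mul_one, map_sum]
  simpa only [splittingLogDeriv, coeff_mk] using sum_pow_pow_pow_eq hy _

theorem mk_one_subst_mul_one_sub {t : R⟦X⟧} (ht : HasSubst t) :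
    (mk 1 : R⟦X⟧).subst t * (1 - t) = 1 := by
  have h := congrArg (substAlgHom ht) (mk_one_mul_one_sub_eq_one R)
  rwa [map_mul, map_sub, map_one, substAlgHom_X, coe_substAlgHom] at h

variable [hp : Fact p.Prime]

/-- The splitting function at `x = y` and `t = 1 - (1 + T) ^ (-p ^ i)`, as a power series in `T`.
Its coefficients are transported to `R` along `θ`. -/
noncomputable def levelSplitting (θ : ℤ_[p] →+* R) (i : ℕ) (y : R) : R⟦X⟧ :=
  (map (Polynomial.eval₂RingHom θ y) (splittingFunction p)).subst (levelParam p R i)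

theorem map_levelSplitting (φ : R →+* S) (θ : ℤ_[p] →+* R) (i : ℕ) (y : R) :
    map φ (levelSplitting θ i y) = levelSplitting (φ.comp θ) i (φ y) := by
  have hcomp : φ.comp (Polynomial.eval₂RingHom θ y) =
      Polynomial.eval₂RingHom (φ.comp θ) (φ y) := by
    ext <;> simp
  refine (map_subst (hasSubst_levelParam i) _).trans ?_
  refine congrArg₂ PowerSeries.subst (map_levelParam φ i) ?_
  rw [← hcomp]
  ext
  simp

theorem constantCoeff_levelSplitting (θ : ℤ_[p] →+* R) (i : ℕ) (y : R) :
    constantCoeff (levelSplitting θ i y) = 1 := by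
  rw [levelSplitting, constantCoeff_subst_of_constantCoeff_eq_zero (constantCoeff_levelParam i),
    ← coeff_zero_eq_constantCoeff_apply, coeff_map, coeff_zero_eq_constantCoeff_apply,
    constantCoeff_splittingFunction, map_one]

theorem hasLogDeriv_levelSplitting (θ : ℤ_[p] →+* R) (i : ℕ) (y : R) :
    HasLogDeriv (levelSplitting θ i y)
      ((splittingLogDeriv p y).subst (levelParam p R i) * d⁄dX R (levelParam p R i)) := by
  have h := hasLogDeriv_splittingFunction (p := p).map (Polynomial.eval₂RingHom θ y)
  rw [map_splittingLogDeriv, Polynomial.coe_eval₂RingHom, Polynomial.eval₂_X] at h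
  exact h.subst (hasSubst_levelParam i)

theorem column_levelSplitting_mem_newtonIdeal {c N i e : ℕ}
    (h : levelParam p ℤ_[p] i ∈ newtonIdeal ℤ_[p] c N e) (u : ℕ) :
    column u (levelSplitting Polynomial.C i (Polynomial.X : ℤ_[p][X])) ∈
      newtonIdeal ℤ_[p] c N (e * u) := by
  have hid : Polynomial.eval₂RingHom Polynomial.C (Polynomial.X : ℤ_[p][X]) = RingHom.id _ := by
    ext <;> simp
  rw [levelSplitting, hid, map_id, id, ← map_levelParam Polynomial.C]
  exact column_subst_mem_newtonIdeal natDegree_coeff_splittingFunction_le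
    (constantCoeff_levelParam i) h u

/-- This is the logarithmic derivative of `(1 + T) ^ (p ^ i Tr y)`. -/
theorem hasLogDeriv_prod_levelSplitting (θ : ℤ_[p] →+* R) (i : ℕ) {r : ℕ} {y : R}
    (hy : y ^ p ^ r = y) :
    HasLogDeriv (∏ j ∈ Finset.range r, levelSplitting θ i (y ^ p ^ j))
      (C (p ^ i * ∑ j ∈ Finset.range r, y ^ p ^ j) * invOneAdd R) := by
  have hs := hasSubst_levelParam (p := p) (R := R) i
  have hC (a : R) : (C a).subst (levelParam p R i) = C a := subst_C a
  convert HasLogDeriv.prod _ fun j _ => hasLogDeriv_levelSplitting θ i (y ^ p ^ j) using 1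
  rw [← Finset.sum_mul, ← coe_substAlgHom hs, ← map_sum, sum_splittingLogDeriv_pow hy, map_mul C,
    map_pow, map_natCast, map_mul, coe_substAlgHom, derivative_levelParam, hC]
  linear_combination (-(p : R⟦X⟧) ^ i * invOneAdd R * C (∑ j ∈ Finset.range r, y ^ p ^ j)) *
    mk_one_subst_mul_one_sub hs

end LevelSplitting

section CharpolyRev

variable {n : Type*} [Fintype n] [DecidableEq n] {R A : Type*} [CommRing R] [CommRing A]

theorem derivation_prod {ι : Type*} [DecidableEq ι] [Algebra R A] (D : Derivation R A A)
    (s : Finset ι) (f : ι → A) : D (∏ i ∈ s, f i) = ∑ i ∈ s, D (f i) * ∏ j ∈ s.erase i, f j := by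
  induction s using Finset.induction_on with
  | empty => simp
  | insert a s ha ih =>
    rw [Finset.prod_insert ha, Derivation.leibniz, ih, Finset.sum_insert ha,
      Finset.erase_insert ha, smul_eq_mul, smul_eq_mul, Finset.mul_sum, add_comm,
      mul_comm (∏ i ∈ s, f i)]
    congr 1
    refine Finset.sum_congr rfl fun i hi => ?_
    have hai : a ≠ i := fun h => ha (h ▸ hi)
    rw [Finset.erase_insert_of_ne hai,
      Finset.prod_insert fun h => ha (Finset.mem_of_mem_erase h)]
    ring

theorem derivation_det [Algebra R A] (D : Derivation R A A) (M : Matrix n n A) :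
    D M.det = (M.adjugate * M.map D).trace := by
  have hcol (i : n) : (M.adjugate * M.map D) i i = (M.updateCol i fun k => D (M k i)).det := by
    rw [← Matrix.cramer_apply, Matrix.cramer_eq_adjugate_mulVec]
    rfl
  simp only [Matrix.trace, Matrix.diag_apply, hcol, Matrix.det_apply', map_sum]
  rw [Finset.sum_comm]
  refine Finset.sum_congr rfl fun σ _ => ?_
  rw [← zsmul_eq_mul, map_zsmul, derivation_prod, zsmul_eq_mul, Finset.mul_sum]
  refine Finset.sum_congr rfl fun i _ => ?_
  rw [← Finset.mul_prod_erase _ _ (Finset.mem_univ i), Matrix.updateCol_self]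
  congr 2
  exact Finset.prod_congr rfl fun j hj => by rw [Matrix.updateCol_ne (Finset.ne_of_mem_erase hj)]

/-- The Neumann series `∑ s ^ k B ^ k`, an inverse of `1 - s B`. -/
def neumannSeries (B : Matrix n n R) : Matrix n n R⟦X⟧ :=
  Matrix.of fun i j => mk fun k => (B ^ k) i j

theorem neumannSeries_mul_map_C (B : Matrix n n R) :
    neumannSeries B * B.map C = Matrix.of fun i j => mk fun k => (B ^ (k + 1)) i j := by
  ext i j k
  simp [neumannSeries, Matrix.mul_apply, pow_succ]

theorem neumannSeries_mul_one_sub (B : Matrix n n R) :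
    neumannSeries B * (1 - (X : R⟦X⟧) • B.map C) = 1 := by
  rw [mul_sub, mul_one, mul_smul_comm, neumannSeries_mul_map_C]
  ext i j k
  rw [Matrix.sub_apply, Matrix.smul_apply, smul_eq_mul, map_sub, Matrix.one_apply]
  rcases k with _ | k
  · by_cases hij : i = j <;> simp [neumannSeries, hij]
  · rw [Matrix.of_apply, coeff_succ_X_mul]
    split_ifs <;> simp [neumannSeries, coeff_one]

theorem adjugate_one_sub (B : Matrix n n R) :
    (1 - (X : R⟦X⟧) • B.map C).adjugate =
      (1 - (X : R⟦X⟧) • B.map C).det • neumannSeries B := by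
  calc
    (1 - (X : R⟦X⟧) • B.map C).adjugate
      = neumannSeries B * (1 - (X : R⟦X⟧) • B.map C) * (1 - (X : R⟦X⟧) • B.map C).adjugate := by
        rw [neumannSeries_mul_one_sub, one_mul]
    _ = (1 - (X : R⟦X⟧) • B.map C).det • neumannSeries B := by
        rw [mul_assoc, Matrix.mul_adjugate, mul_smul_comm, mul_one]

theorem coe_charpolyRev (B : Matrix n n R) :
    (B.charpolyRev : R⟦X⟧) = (1 - (X : R⟦X⟧) • B.map C).det := by
  rw [Matrix.charpolyRev, ← Polynomial.coeToPowerSeries.ringHom_apply, RingHom.map_det]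
  congr 1
  ext1 i j
  simp [Matrix.one_apply, apply_ite, X_mul]

theorem hasLogDeriv_charpolyRev (B : Matrix n n R) :
    HasLogDeriv (B.charpolyRev : R⟦X⟧) (-mk fun k => (B ^ (k + 1)).trace) := by
  have hderiv : (1 - (X : R⟦X⟧) • B.map C).map (d⁄dX R) = -B.map C := by
    ext1 i j
    rcases eq_or_ne i j with rfl | hij <;> simp [*, Derivation.leibniz]
  have htrace : (neumannSeries B * B.map C).trace = mk fun k => (B ^ (k + 1)).trace := by
    ext k
    simp [neumannSeries_mul_map_C, Matrix.trace]
  rw [HasLogDeriv, coe_charpolyRev, derivation_det, hderiv, adjugate_one_sub, Matrix.mul_neg,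
    Matrix.trace_neg, Matrix.smul_mul, Matrix.trace_smul, htrace, smul_eq_mul, neg_mul, mul_comm]

end CharpolyRev

section Minors

/-- The product `A (k - 1) * ⋯ * A 1 * A 0`. -/
def matProd {ι S : Type*} [Fintype ι] [DecidableEq ι] [Semiring S] (A : ℕ → Matrix ι ι S) :
    ℕ → Matrix ι ι S
  | 0 => 1
  | k + 1 => A k * matProd A k

theorem det_mul_eq_sum {m ι S : Type*} [Fintype m] [DecidableEq m] [Fintype ι] [CommRing S]
    (M : Matrix m ι S) (N : Matrix ι m S) :
    (M * N).det = ∑ g : m → ι, (∏ i, M i (g i)) * (N.submatrix g id).det := by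
  classical
  have hMN : M * N = Matrix.of fun i => ∑ k, M i k • N k := by
    ext i j
    simp [Matrix.mul_apply, Finset.sum_apply]
  rw [hMN]
  exact (Matrix.detRowAlternating.toMultilinearMap.map_sum (R := S) fun i k => M i k • N k).trans <|
    Finset.sum_congr rfl fun g _ => Matrix.detRowAlternating.toMultilinearMap.map_smul_univ
      (fun i => M i (g i)) fun i => N (g i)

theorem choose_two_le_sum_of_injective {m : Type*} [Fintype m] {g : m → ℕ}
    (hg : Function.Injective g) : (Fintype.card m).choose 2 ≤ ∑ i, g i := by
  have hinj : Function.Injective fun i => (g i : ℤ) := Nat.cast_injective.comp hg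
  have h := Finset.sum_range_le_sum (s := Finset.univ.map ⟨_, hinj⟩) (c := 0) (by simp)
  rw [Finset.card_map, Finset.sum_map, Finset.card_univ] at h
  rw [Nat.choose_two_right, ← Finset.sum_range_id]
  zify
  simpa using h

variable {R : Type*} [CommRing R] {c N : ℕ}

theorem mul_mem_newtonIdeal_ceil {r s : ℝ} {a b : R⟦X⟧} (ha : a ∈ newtonIdeal R c N ⌈r⌉₊)
    (hb : b ∈ newtonIdeal R c N ⌈s⌉₊) : a * b ∈ newtonIdeal R c N ⌈r + s⌉₊ :=
  newtonIdeal_anti (Nat.ceil_add_le r s) (mul_mem_newtonIdeal ha hb)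

theorem prod_mem_newtonIdeal_ceil {ι : Type*} (s : Finset ι) {r : ι → ℝ} {b : ι → R⟦X⟧}
    (hb : ∀ i ∈ s, b i ∈ newtonIdeal R c N ⌈r i⌉₊) :
    ∏ i ∈ s, b i ∈ newtonIdeal R c N ⌈∑ i ∈ s, r i⌉₊ := by
  refine newtonIdeal_anti (Nat.ceil_le.2 ?_) (prod_mem_newtonIdeal s hb)
  rw [Nat.cast_sum]
  exact Finset.sum_le_sum fun i _ => Nat.le_ceil _

variable {ι : Type*} [Fintype ι] [DecidableEq ι] {w : ι → ℕ} {p : ℕ} {δ : ℝ}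
  {A : ℕ → Matrix ι ι R⟦X⟧}

theorem det_submatrix_matProd_mem_newtonIdeal {m : Type*} [Fintype m] [DecidableEq m]
    (hw : Function.Injective w) (hp : 1 ≤ p) (hδ : 0 < δ)
    (hA : ∀ j u v, A j u v ∈ newtonIdeal R c N ⌈((p : ℝ) * w u - w v) / δ⌉₊) (k : ℕ)
    (h h' : m → ι) :
    ((matProd A (k + 1)).submatrix h h').det ∈ newtonIdeal R c N
      ⌈((p : ℝ) * ∑ i, (w (h i) : ℝ) - ∑ i, (w (h' i) : ℝ) +
        k * ((p - 1) * (Fintype.card m).choose 2)) / δ⌉₊ := by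
  induction k generalizing h with
  | zero =>
    rw [matProd, matProd, mul_one, Matrix.det_apply']
    refine sum_mem fun σ _ => Ideal.mul_mem_left _ _ ?_
    refine newtonIdeal_anti (Nat.ceil_mono (le_of_eq ?_))
      (prod_mem_newtonIdeal_ceil Finset.univ fun i _ => hA 0 (h (σ i)) (h' i))
    rw [← Finset.sum_div, Finset.sum_sub_distrib, ← Finset.mul_sum,
      Equiv.sum_comp σ fun i => (w (h i) : ℝ), Nat.cast_zero, zero_mul, add_zero]
  | succ k ih =>
    rw [matProd, ← Matrix.submatrix_mul_equiv (A (k + 1)) _ h (Equiv.refl ι) h', det_mul_eq_sum]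
    refine sum_mem fun g _ => ?_
    by_cases hg : Function.Injective g
    · refine newtonIdeal_anti (Nat.ceil_mono ?_) (mul_mem_newtonIdeal_ceil
        (prod_mem_newtonIdeal_ceil Finset.univ fun i _ => hA (k + 1) (h i) (g i)) (ih g))
      rw [← Finset.sum_div, Finset.sum_sub_distrib, ← Finset.mul_sum, ← add_div]
      have hp0 : (0 : ℝ) ≤ p - 1 := sub_nonneg.2 (by exact_mod_cast hp)
      have hchoose : ((Fintype.card m).choose 2 : ℝ) ≤ ∑ i, (w (g i) : ℝ) := by
        exact_mod_cast choose_two_le_sum_of_injective (hw.comp hg)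
      refine div_le_div_of_nonneg_right ?_ hδ.le
      rw [Nat.cast_succ]
      linarith [mul_le_mul_of_nonneg_left hchoose hp0]
    · obtain ⟨i, j, hij, hne⟩ : ∃ i j, g i = g j ∧ i ≠ j := by
        simpa [Function.Injective] using hg
      rw [Matrix.det_zero_of_row_eq hne (by ext l; simp [hij]), mul_zero]
      exact zero_mem _

theorem coeff_charpolyRev_matProd_mem_newtonIdeal (hw : Function.Injective w) (hp : 1 ≤ p)
    (hδ : 0 < δ) (hA : ∀ j u v, A j u v ∈ newtonIdeal R c N ⌈((p : ℝ) * w u - w v) / δ⌉₊)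
    {a : ℕ} (ha : 0 < a) (n : ℕ) :
    (matProd A a).charpolyRev.coeff n ∈ newtonIdeal R c N
      ⌈((a : ℝ) * ((p : ℝ) - 1) * (n : ℝ) * ((n : ℝ) - 1)) / (2 * δ)⌉₊ := by
  obtain ⟨k, rfl⟩ := Nat.exists_eq_succ_of_ne_zero ha.ne'
  have hrev : (matProd A (k + 1)).charpolyRev =
      (1 + (Polynomial.X : Polynomial R⟦X⟧) • (-matProd A (k + 1)).map Polynomial.C).det := by
    rw [Matrix.charpolyRev, sub_eq_add_neg, Matrix.map_neg _ (map_neg Polynomial.C), smul_neg]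
  rw [hrev, Matrix.coeff_det_one_add_X_smul_eq_sum_minors]
  refine sum_mem fun s hs => ?_
  rw [Matrix.submatrix_neg, Pi.neg_apply, Pi.neg_apply, Matrix.det_neg]
  refine Ideal.mul_mem_left _ _ (newtonIdeal_anti (Nat.ceil_mono ?_)
    (det_submatrix_matProd_mem_newtonIdeal hw hp hδ hA k (Subtype.val : s → ι) Subtype.val))
  have hcard : Fintype.card s = n := by
    rw [Fintype.card_coe, (Finset.mem_powersetCard.1 hs).2]
  have hchoose : (n.choose 2 : ℝ) ≤ ∑ i : s, (w i : ℝ) := by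
    rw [← hcard]
    exact_mod_cast choose_two_le_sum_of_injective
      (hw.comp (Subtype.val_injective (p := (· ∈ s))))
  have hp0 : (0 : ℝ) ≤ p - 1 := sub_nonneg.2 (by exact_mod_cast hp)
  have hmul := mul_le_mul_of_nonneg_left hchoose hp0
  rw [hcard, ← div_div]
  refine div_le_div_of_nonneg_right ?_ hδ.le
  rw [Nat.cast_choose_two] at hmul ⊢
  rw [Nat.cast_succ]
  linarith

end Minors

section DworkMatrix

variable {S : Type*} [CommRing S] {p q L : ℕ}

/-- The matrix of `g ↦ ψ_q (P g)` on polynomials of degree at most `L`. Dwork's operator `ψ_q`,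
which keeps the monomials `X ^ (q u)` and turns them into `X ^ u`, is `Polynomial.contract q`. -/
noncomputable def dworkMatrix (q L : ℕ) (P : Polynomial S) :
    Matrix (Fin (L + 1)) (Fin (L + 1)) S :=
  Matrix.of fun u v => (Polynomial.contract q (P * Polynomial.X ^ (v : ℕ))).coeff u

theorem dworkMatrix_apply (hq : q ≠ 0) (P : Polynomial S) (u v : Fin (L + 1)) :
    dworkMatrix q L P u v = if (v : ℕ) ≤ u * q then P.coeff (u * q - v) else 0 := by
  rw [dworkMatrix, Matrix.of_apply, Polynomial.coeff_contract hq, Polynomial.coeff_mul_X_pow']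

theorem coeff_contract_mul (hq : q ≠ 0) (P : Polynomial S) {g : Polynomial S}
    (hg : g.natDegree ≤ L) (u : Fin (L + 1)) :
    (Polynomial.contract q (P * g)).coeff u = ∑ v, dworkMatrix q L P u v * g.coeff v := by
  calc (Polynomial.contract q (P * g)).coeff u
      = ∑ v ∈ Finset.range (L + 1),
          (Polynomial.contract q (P * Polynomial.X ^ v)).coeff u * g.coeff v := by
        conv_lhs => rw [g.as_sum_range_C_mul_X_pow' (Nat.lt_add_one_of_le hg), Finset.mul_sum]
        simp only [Polynomial.coeff_contract hq, Polynomial.finsetSum_coeff]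
        refine Finset.sum_congr rfl fun v _ => ?_
        rw [mul_left_comm, Polynomial.coeff_C_mul, mul_comm]
    _ = ∑ v, dworkMatrix q L P u v * g.coeff v := (Fin.sum_univ_eq_sum_range _ _).symm

theorem contract_contract {q' : ℕ} (hq : q ≠ 0) (hq' : q' ≠ 0) (g : Polynomial S) :
    Polynomial.contract q (Polynomial.contract q' g) = Polynomial.contract (q' * q) g := by
  ext n
  rw [Polynomial.coeff_contract hq, Polynomial.coeff_contract hq',
    Polynomial.coeff_contract (mul_ne_zero hq' hq), mul_assoc, mul_comm q]

theorem natDegree_contract_mul_X_pow_le (hq : q ≠ 0) {P : Polynomial S}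
    (hP : P.natDegree ≤ (q - 1) * L) {v : ℕ} (hv : v ≤ L) :
    (Polynomial.contract q (P * Polynomial.X ^ v)).natDegree ≤ L := by
  refine Polynomial.natDegree_le_iff_coeff_eq_zero.2 fun n hn => ?_
  rw [Polynomial.coeff_contract hq]
  refine Polynomial.coeff_eq_zero_of_natDegree_lt ?_
  calc (P * Polynomial.X ^ v).natDegree
      ≤ (q - 1) * L + L := Polynomial.natDegree_mul_le.trans
        (add_le_add hP ((Polynomial.natDegree_X_pow_le v).trans hv))
    _ = L * q := by rw [← Nat.succ_mul, Nat.succ_eq_add_one,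
        Nat.sub_add_cancel (Nat.pos_of_ne_zero hq), mul_comm]
    _ < n * q := Nat.mul_lt_mul_of_pos_right hn (Nat.pos_of_ne_zero hq)

theorem dworkMatrix_mul_dworkMatrix {q' : ℕ} (hq : q ≠ 0) (hq' : q' ≠ 0) (P : Polynomial S)
    {Q : Polynomial S} (hQ : Q.natDegree ≤ (q' - 1) * L) :
    dworkMatrix q L P * dworkMatrix q' L Q =
      dworkMatrix (q' * q) L (Q * Polynomial.expand S q' P) := by
  ext u v
  have hdeg := natDegree_contract_mul_X_pow_le hq' hQ (Nat.lt_succ_iff.1 v.2)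
  calc (dworkMatrix q L P * dworkMatrix q' L Q) u v
      = (Polynomial.contract q (P * Polynomial.contract q' (Q * Polynomial.X ^ (v : ℕ)))).coeff u :=
        (coeff_contract_mul hq P hdeg u).symm
    _ = (Polynomial.contract (q' * q)
          (Q * Polynomial.expand S q' P * Polynomial.X ^ (v : ℕ))).coeff u := by
        rw [mul_comm P, ← Polynomial.contract_mul_expand hq', contract_contract hq hq',
          mul_right_comm]

/-- The product `∏_{j < k} P_j(X ^ (p ^ j))`. -/
noncomputable def twistedProd (p : ℕ) (P : ℕ → Polynomial S) (k : ℕ) : Polynomial S :=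
  ∏ j ∈ Finset.range k, Polynomial.expand S (p ^ j) (P j)

theorem twistedProd_succ (P : ℕ → Polynomial S) (k : ℕ) :
    twistedProd p P (k + 1) = twistedProd p P k * Polynomial.expand S (p ^ k) (P k) :=
  Finset.prod_range_succ _ _

theorem natDegree_twistedProd_le (hp : 1 ≤ p) {P : ℕ → Polynomial S}
    (hP : ∀ j, (P j).natDegree ≤ (p - 1) * L) (k : ℕ) :
    (twistedProd p P k).natDegree ≤ (p ^ k - 1) * L := by
  induction k with
  | zero => simp [twistedProd]
  | succ k ih =>
    calc (twistedProd p P (k + 1)).natDegree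
        ≤ (p ^ k - 1) * L + (p - 1) * L * p ^ k := by
          rw [twistedProd_succ]
          refine Polynomial.natDegree_mul_le.trans (add_le_add ih ?_)
          rw [Polynomial.natDegree_expand]
          exact Nat.mul_le_mul_right _ (hP k)
      _ = (p ^ (k + 1) - 1) * L := by
        zify [hp, Nat.one_le_pow k p hp, Nat.one_le_pow (k + 1) p hp]
        ring

theorem matProd_dworkMatrix (hp : 1 ≤ p) {P : ℕ → Polynomial S}
    (hP : ∀ j, (P j).natDegree ≤ (p - 1) * L) (k : ℕ) :
    matProd (fun j => dworkMatrix p L (P j)) k = dworkMatrix (p ^ k) L (twistedProd p P k) := by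
  have hp0 : p ≠ 0 := Nat.one_le_iff_ne_zero.1 hp
  induction k with
  | zero =>
    ext u v
    simp [matProd, dworkMatrix, twistedProd, Polynomial.contract_one, Polynomial.coeff_X_pow,
      Matrix.one_apply, Fin.ext_iff]
  | succ k ih =>
    rw [matProd, ih, dworkMatrix_mul_dworkMatrix hp0 (pow_ne_zero k hp0) _
      (natDegree_twistedProd_le hp hP k), ← pow_succ, ← twistedProd_succ]

theorem sum_pow_nthRootsFinset {D : Type*} [CommRing D] [IsDomain D] {n : ℕ} (hn : 0 < n)
    {ζ : D} (hζ : IsPrimitiveRoot ζ n) (m : ℕ) :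
    ∑ x ∈ Polynomial.nthRootsFinset n (1 : D), x ^ m = if n ∣ m then (n : D) else 0 := by
  have hmem (x : D) : x ∈ Polynomial.nthRootsFinset n (1 : D) ↔ x ^ n = 1 :=
    Polynomial.mem_nthRootsFinset hn 1
  split_ifs with h
  · obtain ⟨d, rfl⟩ := h
    rw [Finset.sum_congr rfl fun x hx => by rw [pow_mul, (hmem x).1 hx, one_pow], Finset.sum_const,
      hζ.card_nthRootsFinset, nsmul_one]
  · have hinv : ζ ^ (n - 1) * ζ = 1 := by rw [pow_sub_one_mul hn.ne', hζ.pow_eq_one]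
    have hperm : ζ ^ m * ∑ x ∈ Polynomial.nthRootsFinset n (1 : D), x ^ m =
        ∑ x ∈ Polynomial.nthRootsFinset n (1 : D), x ^ m := by
      rw [Finset.mul_sum]
      refine Finset.sum_nbij' (ζ * ·) (ζ ^ (n - 1) * ·) (fun x hx => ?_) (fun x hx => ?_)
        (fun x _ => ?_) (fun x _ => ?_) (fun x _ => (mul_pow ζ x m).symm)
      · rw [hmem, mul_pow, hζ.pow_eq_one, (hmem x).1 hx, one_mul]
      · rw [hmem, mul_pow, pow_right_comm, hζ.pow_eq_one, one_pow, (hmem x).1 hx, one_mul]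
      · rw [← mul_assoc, hinv, one_mul]
      · rw [← mul_assoc, mul_comm ζ, hinv, one_mul]
    refine (mul_eq_zero.1 ?_).resolve_left (sub_ne_zero.2 (mt (hζ.pow_eq_one_iff_dvd m).1 h))
    rw [sub_one_mul, hperm, sub_self]

theorem trace_dworkMatrix {n : ℕ} {H : Polynomial S} :
    (dworkMatrix (n + 1) L H).trace = ∑ u ∈ Finset.range (L + 1), H.coeff (n * u) := by
  rw [Matrix.trace, ← Fin.sum_univ_eq_sum_range fun u => H.coeff (n * u)]
  refine Finset.sum_congr rfl fun u _ => ?_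
  have hu : (u : ℕ) * (n + 1) = n * u + u := by ring
  rw [Matrix.diag_apply, dworkMatrix_apply n.succ_ne_zero, hu, if_pos (Nat.le_add_left _ _),
    Nat.add_sub_cancel]

theorem sum_eval_nthRootsFinset {D : Type*} [CommRing D] [IsDomain D] {n : ℕ} (hn : 0 < n)
    {ζ : D} (hζ : IsPrimitiveRoot ζ n) (φ : D →+* S) {H : Polynomial S}
    (hH : H.natDegree ≤ n * L) :
    ∑ x ∈ Polynomial.nthRootsFinset n (1 : D), H.eval (φ x) =
      n * (dworkMatrix (n + 1) L H).trace := by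
  have hfilter : (Finset.range (n * L + 1)).filter (n ∣ ·) =
      (Finset.range (L + 1)).map ⟨(n * ·), mul_right_injective₀ hn.ne'⟩ := by
    ext m
    simp only [Finset.mem_filter, Finset.mem_range, Nat.lt_succ_iff, Finset.mem_map,
      Function.Embedding.coeFn_mk]
    constructor
    · rintro ⟨hm, u, rfl⟩
      exact ⟨u, Nat.le_of_mul_le_mul_left hm hn, rfl⟩
    · rintro ⟨u, hu, rfl⟩
      exact ⟨Nat.mul_le_mul_left n hu, dvd_mul_right n u⟩
  calc ∑ x ∈ Polynomial.nthRootsFinset n (1 : D), H.eval (φ x)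
      = ∑ m ∈ Finset.range (n * L + 1),
          H.coeff m * φ (∑ x ∈ Polynomial.nthRootsFinset n (1 : D), x ^ m) := by
        simp only [Polynomial.eval_eq_sum_range' (Nat.lt_succ_of_le hH), map_sum, map_pow,
          Finset.mul_sum]
        exact Finset.sum_comm
    _ = ∑ m ∈ (Finset.range (n * L + 1)).filter (n ∣ ·), n * H.coeff m := by
        rw [Finset.sum_filter]
        refine Finset.sum_congr rfl fun m _ => ?_
        rw [sum_pow_nthRootsFinset hn hζ]
        split_ifs <;> simp [mul_comm]
    _ = n * (dworkMatrix (n + 1) L H).trace := by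
        rw [hfilter, Finset.sum_map, trace_dworkMatrix, Finset.mul_sum]
        rfl

end DworkMatrix

section WittTrace

theorem algebraMap_trace_eq_sum_smul (G A : Type*) {B : Type*} [Group G] [Fintype G] [CommRing A]
    [IsDomain A] [IsPrincipalIdealRing A] [CharZero A] [CommRing B] [IsDomain B]
    [IsIntegrallyClosed B] [Algebra A B] [FaithfulSMul A B] [MulSemiringAction G B]
    [IsGaloisGroup G A B] (x : B) : algebraMap A B (Algebra.trace A B x) = ∑ g : G, g • x := by
  have := (IsGaloisGroup.isInvariant (G := G) (A := A) (B := B)).isIntegral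
  let := FractionRing.liftAlgebra A (FractionRing B)
  let := IsFractionRing.mulSemiringAction G B (FractionRing B)
  have := IsGaloisGroup.to_isFractionRing G A B (FractionRing A) (FractionRing B)
  have := IsGaloisGroup.isGalois G (FractionRing A) (FractionRing B)
  have := IsGaloisGroup.finiteDimensional G (FractionRing A) (FractionRing B)
  have := IsIntegralClosure.of_isIntegrallyClosed B A (FractionRing B)
  have := IsIntegralClosure.finite A (FractionRing A) (FractionRing B) B
  have : Module.IsTorsionFree A B := Module.isTorsionFree_iff_faithfulSMul.2 inferInstance
  apply IsFractionRing.injective B (FractionRing B)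
  rw [← Algebra.intTrace_eq_trace, ← IsScalarTower.algebraMap_apply,
    IsScalarTower.algebraMap_apply A (FractionRing A), Algebra.algebraMap_intTrace_fractionRing,
    trace_eq_sum_automorphisms, map_sum]
  exact (Fintype.sum_equiv
    (IsGaloisGroup.mulEquivAlgEquiv G (FractionRing A) (FractionRing B)).toEquiv _ _
    fun g => algebraMap.smul' g x _).symm

variable (p : ℕ) [hp : Fact p.Prime] (K : Type*) [Field K] [CharP K p]

theorem padicIntToWitt_injective : Function.Injective (padicIntToWitt p K) :=
  (WittVector.map_injective _ (ZMod.castHom (dvd_refl p) K).injective).comp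
    (WittVector.equiv p).symm.injective

instance charZero_wittVector : CharZero (WittVector p K) :=
  charZero_of_injective_ringHom (padicIntToWitt_injective p K)

variable {K}

theorem map_comp_padicIntToWitt {K' : Type*} [Field K'] [CharP K' p] (σ : K →+* K') :
    (WittVector.map σ).comp (padicIntToWitt p K) = padicIntToWitt p K' := by
  have h : σ.comp (ZMod.castHom (dvd_refl p) K) = ZMod.castHom (dvd_refl p) K' :=
    RingHom.ext_zmod _ _
  ext z n
  simp only [padicIntToWitt, RingHom.comp_apply, WittVector.map_coeff]
  exact congrArg (fun g : ZMod p →+* K' => g _) h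

variable (K)

/-- The action of the Galois group of a field of characteristic `p` on its Witt vectors. -/
noncomputable abbrev galAction [Algebra (ZMod p) K] :
    MulSemiringAction Gal(K/ZMod p) (WittVector p K) where
  smul g := WittVector.map (g : K →+* K)
  one_smul z := by ext n; rfl
  mul_smul g h z := by ext n; rfl
  smul_zero g := map_zero _
  smul_add g := map_add _
  smul_one g := map_one _
  smul_mul g := map_mul _

theorem isGaloisGroup_wittVector [Finite K] [Algebra (ZMod p) K] :
    letI := (padicIntToWitt p K).toAlgebra
    letI := galAction p K
    IsGaloisGroup Gal(K/ZMod p) ℤ_[p] (WittVector p K) := by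
  let := (padicIntToWitt p K).toAlgebra
  let := galAction p K
  have coeff_smul (g : Gal(K/ZMod p)) (z : WittVector p K) (n : ℕ) :
      (g • z).coeff n = g (z.coeff n) := rfl
  refine ⟨⟨fun {g h} hgh => ?_⟩, ⟨fun g c z => ?_⟩, ⟨fun z hz => ?_⟩⟩
  · ext x
    simpa [coeff_smul] using congrArg (fun z => z.coeff 0) (hgh (WittVector.teichmuller p x))
  · have hc : g • padicIntToWitt p K c = padicIntToWitt p K c :=
      congrArg (fun φ : ℤ_[p] →+* _ => φ c) (map_comp_padicIntToWitt p (g : K →+* K))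
    rw [Algebra.smul_def, smul_mul', Algebra.smul_def]
    exact congrArg (· * g • z) hc
  · have hfixed n : z.coeff n ∈ Set.range (algebraMap (ZMod p) K) :=
      (IsGalois.mem_range_algebraMap_iff_fixed _).2 fun g => by rw [← coeff_smul, hz]
    choose d hd using hfixed
    refine ⟨WittVector.equiv p (WittVector.mk p d), ?_⟩
    ext n
    change (WittVector.map _ ((WittVector.equiv p).symm (WittVector.equiv p _))).coeff n = _
    rw [RingEquiv.symm_apply_apply, WittVector.map_coeff, ← hd]
    exact congrArg (fun φ : ZMod p →+* K => φ (d n)) (RingHom.ext_zmod _ _)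

variable {K}

theorem padicIntToWitt_wittTrace [Finite K] {r : ℕ} (hr : Nat.card K = p ^ r)
    (z : WittVector p K) :
    padicIntToWitt p K (wittTrace p K z) = ∑ j ∈ Finset.range r, (WittVector.frobenius^[j]) z := by
  let := ZMod.algebra K p
  have hrank : Module.finrank (ZMod p) K = r := by
    have hcard := Module.natCard_eq_pow_finrank (K := ZMod p) (V := K)
    rw [hr, Nat.card_zmod] at hcard
    exact (Nat.pow_right_injective hp.out.two_le hcard).symm
  let := (padicIntToWitt p K).toAlgebra
  let := galAction p K
  have := isGaloisGroup_wittVector p K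
  have : FaithfulSMul ℤ_[p] (WittVector p K) :=
    (faithfulSMul_iff_algebraMap_injective _ _).2 (padicIntToWitt_injective p K)
  have := Fintype.ofFinite Gal(K/ZMod p)
  have := Fintype.ofFinite K
  have hfrob (j : ℕ) : FiniteField.frobeniusAlgEquivOfAlgebraic (ZMod p) K ^ j • z =
      (WittVector.frobenius^[j]) z := by
    induction j with
    | zero => rw [pow_zero, one_smul, Function.iterate_zero_apply]
    | succ j ih =>
      rw [pow_succ', mul_smul, ih, Function.iterate_succ_apply',
        WittVector.frobenius_eq_map_frobenius]
      ext n
      change FiniteField.frobeniusAlgEquivOfAlgebraic (ZMod p) K _ = _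
      rw [FiniteField.coe_frobeniusAlgEquivOfAlgebraic, ZMod.card, WittVector.map_coeff,
        frobenius_def]
  calc padicIntToWitt p K (wittTrace p K z) = ∑ g : Gal(K/ZMod p), g • z :=
        algebraMap_trace_eq_sum_smul Gal(K/ZMod p) ℤ_[p] z
    _ = ∑ j : Fin (Module.finrank (ZMod p) K), (WittVector.frobenius^[j]) z :=
        ((FiniteField.bijective_frobeniusAlgEquivOfAlgebraic_pow (ZMod p) K).sum_comp
          (· • z)).symm.trans (Finset.sum_congr rfl fun j _ => hfrob j)
    _ = ∑ j ∈ Finset.range r, (WittVector.frobenius^[j]) z := by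
        rw [Fin.sum_univ_eq_sum_range (fun j => (WittVector.frobenius^[j]) z), hrank]

theorem frobenius_iterate_teichmuller (j : ℕ) (x : K) :
    (WittVector.frobenius^[j]) (WittVector.teichmuller p x) =
      WittVector.teichmuller p x ^ p ^ j := by
  induction j with
  | zero => simp
  | succ j ih =>
    rw [Function.iterate_succ_apply', ih, map_pow, WittVector.frobenius_eq_map_frobenius,
      WittVector.map_teichmuller, frobenius_def, map_pow, ← pow_mul, pow_succ']

theorem exists_isPrimitiveRoot_teichmuller (L : Type*) [Field L] [Finite L] :
    ∃ g : L, IsPrimitiveRoot (WittVector.teichmuller p g) (Nat.card L - 1) := by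
  obtain ⟨g, hg⟩ := IsCyclic.exists_ofOrder_eq_natCard (α := Lˣ)
  rw [Nat.card_units] at hg
  have hgL : IsPrimitiveRoot (g : L) (Nat.card L - 1) :=
    IsPrimitiveRoot.coe_units_iff.2 (hg ▸ IsPrimitiveRoot.orderOf g)
  refine ⟨g, hgL.map_of_injective (f := WittVector.teichmuller p) fun x y hxy => ?_⟩
  simpa using congrArg (fun z => WittVector.coeff z 0) hxy

theorem exists_teichmuller_eq_of_mem_nthRootsFinset [Finite K] {x : WittVector p K}
    (hx : x ∈ Polynomial.nthRootsFinset (Nat.card K - 1) (1 : WittVector p K)) :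
    ∃ y : K, x = WittVector.teichmuller p y := by
  obtain ⟨g, hg⟩ := exists_isPrimitiveRoot_teichmuller p K
  have hpos : 0 < Nat.card K - 1 := Nat.sub_pos_of_lt Finite.one_lt_card
  have : NeZero (Nat.card K - 1) := ⟨hpos.ne'⟩
  obtain ⟨i, -, hi⟩ := hg.eq_pow_of_pow_eq_one ((Polynomial.mem_nthRootsFinset hpos 1).1 hx)
  exact ⟨g ^ i, by rw [← hi, map_pow]⟩

end WittTrace

section Periodic

variable {ι S : Type*} [Fintype ι] [DecidableEq ι] [CommRing S]

theorem matProd_add (A : ℕ → Matrix ι ι S) (m n : ℕ) :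
    matProd A (m + n) = matProd (fun j => A (j + n)) m * matProd A n := by
  induction m with
  | zero => simp [matProd]
  | succ m ih => rw [Nat.succ_add, matProd, ih, matProd, mul_assoc]

theorem matProd_mul_of_periodic {A : ℕ → Matrix ι ι S} {a : ℕ} (hA : Function.Periodic A a)
    (k : ℕ) : matProd A (a * k) = matProd A a ^ k := by
  induction k with
  | zero => simp [matProd]
  | succ k ih =>
    have hshift : (fun j => A (j + a * k)) = A := funext (mul_comm a k ▸ hA.nat_mul k)
    rw [mul_add, mul_one, add_comm, matProd_add, hshift, ih, pow_succ']

end Periodic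

section Truncation

variable {A : Type*} [CommRing A]

/-- The part of degree at most `L` in `x` of a series over `A[x]`, as a polynomial over `A⟦T⟧`. -/
noncomputable def truncDegree (L : ℕ) (h : (Polynomial A)⟦X⟧) : Polynomial A⟦X⟧ :=
  ∑ u ∈ Finset.range (L + 1), Polynomial.monomial u (column u h)

theorem coeff_truncDegree (L : ℕ) (h : (Polynomial A)⟦X⟧) (u : ℕ) :
    (truncDegree L h).coeff u = if u ≤ L then column u h else 0 := by
  simp [truncDegree, Polynomial.coeff_monomial]

theorem natDegree_truncDegree_le (L : ℕ) (h : (Polynomial A)⟦X⟧) :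
    (truncDegree L h).natDegree ≤ L :=
  Polynomial.natDegree_le_iff_coeff_eq_zero.2 fun u hu => by
    rw [coeff_truncDegree, if_neg (Nat.not_le.2 hu)]

theorem natDegree_truncDegree_le_sub_one_mul {p : ℕ} (hp : 1 < p) (L : ℕ)
    (h : (Polynomial A)⟦X⟧) : (truncDegree L h).natDegree ≤ (p - 1) * L :=
  (natDegree_truncDegree_le L h).trans (Nat.le_mul_of_pos_left L (Nat.sub_pos_of_lt hp))

theorem dworkMatrix_truncDegree_mem_newtonIdeal {c N q L : ℕ} (hq : q ≠ 0) {δ : ℝ}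
    {h : (Polynomial A)⟦X⟧} (hh : h ∈ weightMonoid A c N δ) (u v : Fin (L + 1)) :
    dworkMatrix q L (truncDegree L h) u v ∈
      newtonIdeal A c N ⌈((q : ℝ) * (u : ℕ) - (v : ℕ)) / δ⌉₊ := by
  rw [dworkMatrix_apply hq, coeff_truncDegree]
  split_ifs with hv
  · have hcol := hh (u * q - v)
    rwa [Nat.cast_sub hv, Nat.cast_mul, mul_comm] at hcol
  · exact zero_mem _
  · exact zero_mem _

theorem natDegree_coeff_le_of_mem_weightMonoid {D : ℕ} (hD : 0 < D) {h : (Polynomial A)⟦X⟧}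
    (hh : h ∈ weightMonoid A 0 1 D) (j : ℕ) : (coeff j h).natDegree ≤ D * j := by
  refine Polynomial.natDegree_le_iff_coeff_eq_zero.2 fun u hu => ?_
  have hj : j < ⌈(u : ℝ) / D⌉₊ := by
    rw [Nat.lt_ceil, lt_div_iff₀ (by exact_mod_cast hD)]
    exact_mod_cast (mul_comm D j ▸ hu)
  have hdvd := hh u j
  rwa [ceilDiv_one, Nat.cast_zero, zero_pow (Nat.sub_ne_zero_of_lt hj), zero_dvd_iff,
    coeff_column] at hdvd

theorem X_pow_dvd_eval_truncDegree_sub {B : Type*} [CommRing B] (ρ : A →+* B) (x : B) {D : ℕ}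
    (M : ℕ) {h : (Polynomial A)⟦X⟧} (hh : ∀ j, (coeff j h).natDegree ≤ D * j) :
    X ^ M ∣ ((truncDegree (D * M) h).map (map ρ)).eval (C x) -
      map (Polynomial.eval₂RingHom ρ x) h := by
  refine X_pow_dvd_iff.2 fun j hj => ?_
  have hdeg : ((truncDegree (D * M) h).map (map ρ)).natDegree < D * M + 1 :=
    Nat.lt_succ_of_le (Polynomial.natDegree_map_le.trans (natDegree_truncDegree_le _ _))
  rw [map_sub, sub_eq_zero, coeff_map, Polynomial.coe_eval₂RingHom,
    Polynomial.eval₂_eq_sum_range' _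
      (Nat.lt_succ_of_le ((hh j).trans (Nat.mul_le_mul_left D hj.le))),
    Polynomial.eval_eq_sum_range' hdeg, map_sum]
  refine Finset.sum_congr rfl fun u hu => ?_
  rw [Polynomial.coeff_map, coeff_truncDegree, if_pos (Finset.mem_range_succ_iff.1 hu), ← map_pow,
    coeff_mul_C, coeff_map, coeff_column]

end Truncation

section Binomial

variable {R : Type*} [CommRing R] [BinomialRing R]

theorem succ_mul_ringChoose_succ (z : R) (n : ℕ) :
    ((n : R) + 1) * Ring.choose z (n + 1) = (z - n) * Ring.choose z n := by
  have h := Ring.choose_smul_choose z (Nat.le_succ n)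
  rw [Nat.choose_succ_self_right, Nat.succ_sub le_rfl, Nat.sub_self, Ring.choose_one_right,
    nsmul_eq_mul] at h
  push_cast at h
  linear_combination h

theorem hasLogDeriv_binomialSeries (z : R) :
    HasLogDeriv (binomialSeries R z) (C z * invOneAdd R) := by
  have hderiv : (1 + X) * d⁄dX R (binomialSeries R z) = C z * binomialSeries R z := by
    ext n
    have hrec := succ_mul_ringChoose_succ z n
    rw [add_mul, one_mul, map_add, coeff_C_mul]
    rcases n with _ | n
    · simp [coeff_derivative]
    · simp only [coeff_succ_X_mul, coeff_derivative, binomialSeries_coeff, smul_eq_mul, mul_one]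
        at hrec ⊢
      push_cast at hrec ⊢
      linear_combination hrec
  rw [HasLogDeriv]
  linear_combination invOneAdd R * hderiv -
    d⁄dX R (binomialSeries R z) * one_add_X_mul_invOneAdd (R := R)

end Binomial

section TraceFormula

theorem X_pow_dvd_of_X_pow_dvd_map {R S : Type*} [CommRing R] [CommRing S] {φ : R →+* S}
    (hφ : Function.Injective φ) {M : ℕ} {g : R⟦X⟧} (h : X ^ M ∣ map φ g) : X ^ M ∣ g :=
  X_pow_dvd_iff.2 fun m hm => hφ <| by rw [← coeff_map, X_pow_dvd_iff.1 h m hm, map_zero]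

theorem X_pow_dvd_prod_sub_prod {A ι : Type*} [CommRing A] (s : Finset ι) {M : ℕ}
    {g h : ι → A⟦X⟧} (hgh : ∀ i ∈ s, X ^ M ∣ g i - h i) :
    X ^ M ∣ ∏ i ∈ s, g i - ∏ i ∈ s, h i := by
  simp only [← Ideal.mem_span_singleton, ← Ideal.Quotient.eq] at hgh ⊢
  rw [map_prod, map_prod]
  exact Finset.prod_congr rfl hgh

theorem map_dworkMatrix {S S' : Type*} [CommRing S] [CommRing S'] (φ : S →+* S') {q : ℕ}
    (hq : q ≠ 0) (L : ℕ) (P : Polynomial S) :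
    (dworkMatrix q L P).map φ = dworkMatrix q L (P.map φ) := by
  ext u v
  rw [Matrix.map_apply, dworkMatrix_apply hq, dworkMatrix_apply hq, Polynomial.coeff_map]
  split_ifs <;> simp

theorem map_twistedProd {S S' : Type*} [CommRing S] [CommRing S'] (φ : S →+* S') (p : ℕ)
    (P : ℕ → Polynomial S) (k : ℕ) :
    (twistedProd p P k).map φ = twistedProd p (fun j => (P j).map φ) k := by
  simp [twistedProd, Polynomial.map_prod, Polynomial.map_expand]

theorem teichmuller_pow_card (p : ℕ) [Fact p.Prime] {K : Type*} [Field K] [Finite K] (y : K) :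
    WittVector.teichmuller p y ^ Nat.card K = WittVector.teichmuller p y := by
  have := Fintype.ofFinite K
  rw [← map_pow, Nat.card_eq_fintype_card, FiniteField.pow_card]

variable (p : ℕ) [hp : Fact p.Prime] {F : Type*} [Field F] (f : ℕ → Polynomial F)

/-- The pairs `(i, u)` of an index `i < l` and an exponent `u ≤ deg f_i`, which index the terms of
`∑_{i < l} p ^ i f̂_i`. -/
def termIndices (l : ℕ) : Finset (Σ _ : ℕ, ℕ) :=
  (Finset.range l).sigma fun i => Finset.range ((f i).natDegree + 1)

/-- The partial sum `∑_{i < l} p ^ i f̂_i` of `f̂`. -/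
noncomputable def partialHat (l : ℕ) : Polynomial (WittVector p F) :=
  ∑ s ∈ termIndices f l, Polynomial.monomial s.2
    ((p : WittVector p F) ^ s.1 * WittVector.teichmuller p ((f s.1).coeff s.2))

variable {K : Type*} [Field K] (σ : F →+* K)

/-- The value at `[y]` of the monomial of `f̂_i` of degree `u`, where `s = (i, u)`. -/
noncomputable def teichmullerTerm (y : K) (s : Σ _ : ℕ, ℕ) : WittVector p K :=
  WittVector.teichmuller p (σ ((f s.1).coeff s.2) * y ^ s.2)

variable [CharP K p]

theorem padicIntToWitt_wittTrace_partialHat [Finite K] {r : ℕ} (hK : Nat.card K = p ^ r) (l : ℕ)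
    (y : K) :
    padicIntToWitt p K (wittTrace p K
        ((partialHat p f l).eval₂ (WittVector.map σ) (WittVector.teichmuller p y))) =
      ∑ s ∈ termIndices f l, (p : WittVector p K) ^ s.1 *
        ∑ j ∈ Finset.range r, teichmullerTerm p f σ y s ^ p ^ j := by
  have heval : (partialHat p f l).eval₂ (WittVector.map σ) (WittVector.teichmuller p y) =
      ∑ s ∈ termIndices f l, (p : WittVector p K) ^ s.1 * teichmullerTerm p f σ y s := by
    simp only [partialHat, teichmullerTerm, Polynomial.eval₂_finsetSum, Polynomial.eval₂_monomial,
      map_mul, map_pow, map_natCast, WittVector.map_teichmuller, mul_assoc]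
  simp only [padicIntToWitt_wittTrace p hK, heval, Finset.mul_sum]
  rw [Finset.sum_comm]
  refine Finset.sum_congr rfl fun j _ => ?_
  rw [← RingHom.coe_pow]
  simp only [map_sum, map_mul, map_pow, map_natCast]
  simp only [RingHom.coe_pow, teichmullerTerm, frobenius_iterate_teichmuller]

variable [CharP F p]

/-- The splitting function of `∑_{i < l} p ^ i f̂_i`, a product over its terms, with the `j`-th
power of the Frobenius applied to the coefficients. -/
noncomputable def conjSplitting (l j : ℕ) : (Polynomial (WittVector p F))⟦X⟧ :=
  ∏ s ∈ termIndices f l, levelSplitting (Polynomial.C.comp (padicIntToWitt p F)) s.1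
    (Polynomial.C (WittVector.teichmuller p ((f s.1).coeff s.2) ^ p ^ j) * Polynomial.X ^ s.2)

theorem conjSplitting_mem_weightMonoid {c N : ℕ} {δ : ℝ} (hδ : 0 < δ) {e : ℕ → ℕ}
    (he : ∀ i, levelParam p ℤ_[p] i ∈ newtonIdeal ℤ_[p] c N (e i))
    (hd : ∀ i, ((f i).natDegree : ℝ) ≤ δ * e i) (l j : ℕ) :
    conjSplitting p f l j ∈ weightMonoid (WittVector p F) c N δ := by
  refine Submonoid.prod_mem _ fun s hs => ?_
  have hs2 : s.2 ≤ (f s.1).natDegree := Finset.mem_range_succ_iff.1 (Finset.mem_sigma.1 hs).2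
  convert map_eval₂_mem_weightMonoid (padicIntToWitt p F) hδ
    ((Nat.cast_le.2 hs2).trans (hd s.1)) (WittVector.teichmuller p ((f s.1).coeff s.2) ^ p ^ j)
    (column_levelSplitting_mem_newtonIdeal (he s.1)) using 1
  rw [map_levelSplitting]
  congr 1
  · ext1 z
    simp
  · simp

theorem natDegree_coeff_conjSplitting_le {D : ℕ} (hD : 0 < D) (hfD : ∀ i, (f i).natDegree ≤ D)
    (l j n : ℕ) : (coeff n (conjSplitting p f l j)).natDegree ≤ D * n :=
  natDegree_coeff_le_of_mem_weightMonoid hD (conjSplitting_mem_weightMonoid p f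
    (Nat.cast_pos.2 hD) (e := fun _ => 1)
    (fun i => mem_newtonIdeal_one (constantCoeff_levelParam i))
    (fun i => by simpa using hfD i) l j) n

theorem conjSplitting_periodic [Finite F] {a : ℕ} (hF : Nat.card F = p ^ a) (l : ℕ) :
    Function.Periodic (conjSplitting p f l) a := by
  intro j
  have hteich (y : F) : WittVector.teichmuller p y ^ p ^ (j + a) =
      WittVector.teichmuller p y ^ p ^ j := by
    rw [pow_add, mul_comm, pow_mul, ← hF, teichmuller_pow_card]
  simp only [conjSplitting, hteich]

theorem map_eval₂_conjSplitting (l j : ℕ) (y : K) :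
    map (Polynomial.eval₂RingHom (WittVector.map σ) (WittVector.teichmuller p y ^ p ^ j))
        (conjSplitting p f l j) =
      ∏ s ∈ termIndices f l,
        levelSplitting (padicIntToWitt p K) s.1 (teichmullerTerm p f σ y s ^ p ^ j) := by
  rw [conjSplitting, map_prod]
  refine Finset.prod_congr rfl fun s _ => ?_
  rw [map_levelSplitting]
  congr 1
  · rw [← map_comp_padicIntToWitt p σ]
    ext1 z
    simp
  · simp only [teichmullerTerm, map_mul, map_pow, Polynomial.coe_eval₂RingHom, Polynomial.eval₂_C,
      Polynomial.eval₂_X, WittVector.map_teichmuller]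
    ring

theorem prod_map_eval₂_conjSplitting [Finite K] {r : ℕ} (hK : Nat.card K = p ^ r) (l : ℕ)
    (y : K) :
    ∏ j ∈ Finset.range r, map (Polynomial.eval₂RingHom (WittVector.map σ)
        (WittVector.teichmuller p y ^ p ^ j)) (conjSplitting p f l j) =
      map (padicIntToWitt p K) (binomialSeries ℤ_[p] (wittTrace p K
        ((partialHat p f l).eval₂ (WittVector.map σ) (WittVector.teichmuller p y)))) := by
  have hperiod (s : Σ _ : ℕ, ℕ) :
      teichmullerTerm p f σ y s ^ p ^ r = teichmullerTerm p f σ y s := by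
    rw [teichmullerTerm, ← hK, teichmuller_pow_card]
  simp only [map_eval₂_conjSplitting]
  rw [Finset.prod_comm]
  have hprod := HasLogDeriv.prod (termIndices f l) fun s _ =>
    hasLogDeriv_prod_levelSplitting (padicIntToWitt p K) s.1 (hperiod s)
  rw [← Finset.sum_mul, ← map_sum, ← padicIntToWitt_wittTrace_partialHat p f σ hK] at hprod
  have hbin := (hasLogDeriv_binomialSeries (wittTrace p K ((partialHat p f l).eval₂
    (WittVector.map σ) (WittVector.teichmuller p y)))).map (padicIntToWitt p K)
  rw [map_mul (map _), map_C, map_invOneAdd] at hbin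
  refine hprod.eq_of_constantCoeff_eq hbin ?_
  rw [← coeff_zero_eq_constantCoeff_apply (map _ _), coeff_map, coeff_zero_eq_constantCoeff_apply,
    binomialSeries_constantCoeff, map_one]
  simp [constantCoeff_levelSplitting]

/-- The exponential sum over `K` attached to a polynomial over `W(F)`. -/
noncomputable def polyExpSum (g : Polynomial (WittVector p F)) : ℤ_[p]⟦X⟧ :=
  ∑ x ∈ Polynomial.nthRootsFinset (Nat.card K - 1) (1 : WittVector p K),
    binomialSeries ℤ_[p] (wittTrace p K (g.eval₂ (WittVector.map σ) x))

theorem map_map_padicIntToWitt (b : ℤ_[p]⟦X⟧) :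
    map (WittVector.map σ) (map (padicIntToWitt p F) b) = map (padicIntToWitt p K) b := by
  rw [← map_comp_padicIntToWitt p σ]
  rfl

/-- The Dwork matrix of the splitting function of `∑_{i < l} p ^ i f̂_i`, twisted by the `j`-th
power of the Frobenius and truncated to degrees at most `L`. -/
noncomputable def frobMatrix (l L j : ℕ) :
    Matrix (Fin (L + 1)) (Fin (L + 1)) (WittVector p F)⟦X⟧ :=
  dworkMatrix p L (truncDegree L (conjSplitting p f l j))

theorem matProd_frobMatrix_pow [Finite F] {a : ℕ} (hF : Nat.card F = p ^ a) (l L k : ℕ) :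
    matProd (frobMatrix p f l L) a ^ k = dworkMatrix (p ^ (a * k)) L
      (twistedProd p (fun j => truncDegree L (conjSplitting p f l j)) (a * k)) := by
  have hperiod : Function.Periodic (frobMatrix p f l L) a := fun j => by
    rw [frobMatrix, conjSplitting_periodic p f hF, frobMatrix]
  rw [← matProd_mul_of_periodic hperiod, ← matProd_dworkMatrix hp.out.one_lt.le fun j =>
    natDegree_truncDegree_le_sub_one_mul hp.out.one_lt L (conjSplitting p f l j)]
  rfl

theorem X_pow_dvd_eval_twistedProd_sub [Finite K] {r : ℕ} (hK : Nat.card K = p ^ r) {D : ℕ}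
    (hD : 0 < D) (hfD : ∀ i, (f i).natDegree ≤ D) (l M : ℕ) (y : K) :
    X ^ M ∣ ((twistedProd p (fun j => truncDegree (D * M) (conjSplitting p f l j)) r).map
          (map (WittVector.map σ))).eval (C (WittVector.teichmuller p y)) -
        map (padicIntToWitt p K) (binomialSeries ℤ_[p] (wittTrace p K
          ((partialHat p f l).eval₂ (WittVector.map σ) (WittVector.teichmuller p y)))) := by
  rw [← prod_map_eval₂_conjSplitting p f σ hK, map_twistedProd, twistedProd, Polynomial.eval_prod]
  refine X_pow_dvd_prod_sub_prod _ fun j _ => ?_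
  rw [Polynomial.expand_eval, ← map_pow]
  exact X_pow_dvd_eval_truncDegree_sub _ _ _ (natDegree_coeff_conjSplitting_le p f hD hfD l j)

theorem X_pow_dvd_trace_sub_polyExpSum [Finite F] [Finite K] {a k : ℕ}
    (hF : Nat.card F = p ^ a) (hK : Nat.card K = p ^ (a * k)) {D : ℕ} (hD : 0 < D)
    (hfD : ∀ i, (f i).natDegree ≤ D) (l M : ℕ) :
    X ^ M ∣ ((p ^ (a * k) - 1 : ℕ) : (WittVector p F)⟦X⟧) *
        (matProd (frobMatrix p f l (D * M)) a ^ k).trace -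
      map (padicIntToWitt p F) (polyExpSum p σ (partialHat p f l)) := by
  let H := twistedProd p (fun j => truncDegree (D * M) (conjSplitting p f l j)) (a * k)
  let ρ : (WittVector p F)⟦X⟧ →+* (WittVector p K)⟦X⟧ := map (WittVector.map σ)
  have hn : 0 < p ^ (a * k) - 1 := by
    rw [← hK]
    exact Nat.sub_pos_of_lt Finite.one_lt_card
  have hdeg : (H.map ρ).natDegree ≤ (p ^ (a * k) - 1) * (D * M) :=
    Polynomial.natDegree_map_le.trans <| natDegree_twistedProd_le hp.out.one_lt.le (fun j =>
      natDegree_truncDegree_le_sub_one_mul hp.out.one_lt (D * M) (conjSplitting p f l j)) (a * k)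
  obtain ⟨g, hg⟩ := exists_isPrimitiveRoot_teichmuller p K
  rw [hK] at hg
  have htrace : ρ (((p ^ (a * k) - 1 : ℕ) : (WittVector p F)⟦X⟧) *
        (matProd (frobMatrix p f l (D * M)) a ^ k).trace) =
      ∑ x ∈ Polynomial.nthRootsFinset (p ^ (a * k) - 1) 1, (H.map ρ).eval (C x) := by
    rw [sum_eval_nthRootsFinset hn hg C hdeg, Nat.sub_add_cancel (Nat.one_le_pow _ _ hp.out.pos),
      ← map_dworkMatrix ρ (pow_ne_zero _ hp.out.ne_zero), matProd_frobMatrix_pow p f hF, map_mul,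
      map_natCast, AddMonoidHom.map_trace]
  refine X_pow_dvd_of_X_pow_dvd_map (WittVector.map_injective σ σ.injective) ?_
  rw [map_sub, htrace, map_map_padicIntToWitt, polyExpSum, map_sum, hK, ← Finset.sum_sub_distrib]
  refine Finset.dvd_sum fun x hx => ?_
  obtain ⟨y, rfl⟩ := exists_teichmuller_eq_of_mem_nthRootsFinset p (hK ▸ hx)
  exact X_pow_dvd_eval_twistedProd_sub p f σ hK hD hfD l M y

end TraceFormula

section Descent

variable (p : ℕ) [hp : Fact p.Prime]

theorem exists_mem_newtonIdeal_map_eq {A B : Type*} [CommRing A] [CommRing B] (φ : A →+* B)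
    {c N K : ℕ} {b : B⟦X⟧} (h : ∀ j, ∃ y, φ ((c : A) ^ ((K - j) ⌈/⌉ N) * y) = coeff j b) :
    ∃ y ∈ newtonIdeal A c N K, map φ y = b := by
  choose y hy using h
  refine ⟨mk fun j => (c : A) ^ ((K - j) ⌈/⌉ N) * y j, fun j => ?_, ?_⟩
  · rw [coeff_mk]
    exact dvd_mul_right _ _
  · ext1 j
    rw [coeff_map, coeff_mk, hy]

/-- The logarithmic derivative of `exp (- ∑ k, (q ^ (k + 1) - 1)⁻¹ S k s ^ (k + 1) / (k + 1))`. The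
index of the sums `S` is shifted by one: `S k` stands for the sum over the extension of degree
`k + 1`. -/
noncomputable def sumLogDeriv (q : ℕ) (S : ℕ → ℤ_[p]⟦X⟧) : ℚ_[p]⟦X⟧⟦X⟧ :=
  mk fun k => -(((q : ℚ_[p]) ^ (k + 1) - 1)⁻¹ • map (algebraMap ℤ_[p] ℚ_[p]) (S k))

theorem natCast_mul_coeff_sumLogDeriv {q : ℕ} (hq : 1 < q) (S : ℕ → ℤ_[p]⟦X⟧) (k : ℕ) :
    ((q ^ (k + 1) - 1 : ℕ) : ℚ_[p]⟦X⟧) * coeff k (sumLogDeriv p q S) =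
      -map (algebraMap ℤ_[p] ℚ_[p]) (S k) := by
  have hq' : 1 < q ^ (k + 1) := Nat.one_lt_pow k.succ_ne_zero hq
  have hcast : ((q ^ (k + 1) - 1 : ℕ) : ℚ_[p]) = (q : ℚ_[p]) ^ (k + 1) - 1 := by
    rw [Nat.cast_sub hq'.le, Nat.cast_pow, Nat.cast_one]
  rw [sumLogDeriv, coeff_mk, ← hcast, ← nsmul_eq_mul, smul_neg, ← Nat.cast_smul_eq_nsmul ℚ_[p],
    smul_inv_smul₀ (Nat.cast_ne_zero.2 (Nat.sub_ne_zero_of_lt hq'))]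

variable (F : Type*) [Field F] [CharP F p]

/-- The inclusion of `ℚ_p` in the fraction field of `W(F)`. -/
noncomputable def padicToFrac : ℚ_[p] →+* FractionRing (WittVector p F) :=
  IsFractionRing.lift (A := ℤ_[p]) (K := ℚ_[p])
    (g := (algebraMap (WittVector p F) (FractionRing (WittVector p F))).comp (padicIntToWitt p F))
    ((IsFractionRing.injective _ _).comp (padicIntToWitt_injective p F))

theorem padicToFrac_algebraMap (z : ℤ_[p]) :
    padicToFrac p F (algebraMap ℤ_[p] ℚ_[p] z) =
      algebraMap (WittVector p F) (FractionRing (WittVector p F)) (padicIntToWitt p F z) :=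
  IsFractionRing.lift_algebraMap _ _

theorem map_padicToFrac_map_algebraMap (b : ℤ_[p]⟦X⟧) :
    map (padicToFrac p F) (map (algebraMap ℤ_[p] ℚ_[p]) b) =
      map (algebraMap (WittVector p F) (FractionRing (WittVector p F)))
        (map (padicIntToWitt p F) b) := by
  ext1 j
  simp only [coeff_map, padicToFrac_algebraMap]

variable {F}

theorem isUnit_of_isUnit_padicIntToWitt {y : ℤ_[p]} (h : IsUnit (padicIntToWitt p F y)) :
    IsUnit y := by
  by_contra hy
  have hp_dvd : (p : ℤ_[p]) ∣ y := by
    rwa [← Ideal.mem_span_singleton, ← PadicInt.maximalIdeal_eq_span_p]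
  obtain ⟨t, rfl⟩ := hp_dvd
  have hunit := h.map (WittVector.constantCoeff (p := p))
  rw [map_mul, map_mul, map_natCast, map_natCast, CharP.cast_eq_zero, zero_mul] at hunit
  exact not_isUnit_zero hunit

theorem exists_algebraMap_eq_of_padicToFrac_eq {x : ℚ_[p]} {w : WittVector p F}
    (h : padicToFrac p F x = algebraMap _ _ w) : ∃ y : ℤ_[p], algebraMap ℤ_[p] ℚ_[p] y = x := by
  by_contra! hne
  have hx : 1 < ‖x‖ := not_le.1 fun hx => hne ⟨x, hx⟩ rfl
  let y : ℤ_[p] := ⟨x⁻¹, by rw [norm_inv]; exact inv_le_one_of_one_le₀ hx.le⟩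
  have hyx : algebraMap ℤ_[p] ℚ_[p] y * x = 1 :=
    inv_mul_cancel₀ (norm_pos_iff.1 (one_pos.trans hx))
  have hyw : padicIntToWitt p F y * w = 1 :=
    IsFractionRing.injective (WittVector p F) (FractionRing (WittVector p F)) <| by
      rw [map_mul, ← padicToFrac_algebraMap, ← h, ← map_mul, hyx, map_one, map_one]
  have hnorm : ‖x⁻¹‖ = 1 :=
    PadicInt.isUnit_iff.1 (isUnit_of_isUnit_padicIntToWitt p (IsUnit.of_mul_eq_one _ hyw))
  rw [norm_inv, inv_eq_one] at hnorm
  exact hx.ne' hnorm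

theorem exists_algebraMap_natCast_mul_eq {x : ℚ_[p]} {w : WittVector p F} {m : ℕ}
    (h : padicToFrac p F x = algebraMap _ _ w) (hw : (m : WittVector p F) ∣ w) :
    ∃ y : ℤ_[p], algebraMap ℤ_[p] ℚ_[p] (m * y) = x := by
  obtain ⟨v, rfl⟩ := hw
  rcases eq_or_ne m 0 with rfl | hm
  · have hx : x = 0 := (map_eq_zero (padicToFrac p F)).1 (by simpa using h)
    exact ⟨0, by simp [hx]⟩
  · have hv : padicToFrac p F (x / m) = algebraMap _ _ v := by
      rw [map_div₀, h, map_mul, map_natCast, map_natCast,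
        mul_div_cancel_left₀ _ (Nat.cast_ne_zero.2 hm)]
    obtain ⟨y, hy⟩ := exists_algebraMap_eq_of_padicToFrac_eq p hv
    refine ⟨y, ?_⟩
    rw [map_mul, hy, map_natCast, mul_div_cancel₀ _ (Nat.cast_ne_zero.2 hm)]

theorem X_pow_dvd_coeff_sumLogDeriv_add {q : ℕ} (hq : 1 < q) {S : ℕ → ℤ_[p]⟦X⟧} {k M : ℕ}
    {t : (WittVector p F)⟦X⟧}
    (h : X ^ M ∣ ((q ^ (k + 1) - 1 : ℕ) : (WittVector p F)⟦X⟧) * t -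
      map (padicIntToWitt p F) (S k)) :
    X ^ M ∣ map (padicToFrac p F) (coeff k (sumLogDeriv p q S)) +
      map (algebraMap (WittVector p F) (FractionRing (WittVector p F))) t := by
  let κ := map (algebraMap (WittVector p F) (FractionRing (WittVector p F)))
  have hunit : IsUnit ((q ^ (k + 1) - 1 : ℕ) : (FractionRing (WittVector p F))⟦X⟧) := by
    rw [isUnit_iff_constantCoeff, map_natCast]
    exact (Nat.cast_ne_zero.2 (Nat.sub_ne_zero_of_lt (Nat.one_lt_pow k.succ_ne_zero hq))).isUnit
  have hlog := congrArg (map (padicToFrac p F)) (natCast_mul_coeff_sumLogDeriv p hq S k)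
  rw [map_mul, map_natCast (map (padicToFrac p F)), map_neg, map_padicToFrac_map_algebraMap] at hlog
  have hκ := map_dvd κ h
  rw [map_pow, map_X, map_sub, map_mul, map_natCast κ, sub_eq_neg_add, ← hlog, ← mul_add] at hκ
  exact (hunit.dvd_mul_left).1 hκ

theorem X_pow_dvd_coeff_sub_coeff_charpolyRev {q : ℕ} (hq : 1 < q) {S : ℕ → ℤ_[p]⟦X⟧}
    {g : ℚ_[p]⟦X⟧⟦X⟧} (hg0 : constantCoeff g = 1) (hg : HasLogDeriv g (sumLogDeriv p q S))
    {ι : Type*} [Fintype ι] [DecidableEq ι] {M : ℕ} {B : Matrix ι ι (WittVector p F)⟦X⟧}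
    (hB : ∀ k, X ^ M ∣ ((q ^ (k + 1) - 1 : ℕ) : (WittVector p F)⟦X⟧) * (B ^ (k + 1)).trace -
      map (padicIntToWitt p F) (S k)) (n : ℕ) :
    X ^ M ∣ map (padicToFrac p F) (coeff n g) -
      map (algebraMap (WittVector p F) (FractionRing (WittVector p F)))
        (B.charpolyRev.coeff n) := by
  let κ := map (algebraMap (WittVector p F) (FractionRing (WittVector p F)))
  have hconst : constantCoeff (map (map (padicToFrac p F)) g) =
      constantCoeff (map κ (B.charpolyRev : (WittVector p F)⟦X⟧⟦X⟧)) := by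
    simp only [← coeff_zero_eq_constantCoeff_apply, coeff_map, Polynomial.coeff_coe,
      Polynomial.coeff_zero_eq_eval_zero, Matrix.eval_charpolyRev]
    rw [coeff_zero_eq_constantCoeff_apply, hg0, map_one, map_one]
  have hmem := (hg.map (map (padicToFrac p F))).coeff_sub_mem
    (I := Ideal.span {X ^ M}) ((hasLogDeriv_charpolyRev B).map κ) hconst (fun k => by
      rw [Ideal.mem_span_singleton, coeff_map, coeff_map, map_neg, map_neg, coeff_mk,
        sub_neg_eq_add]
      exact X_pow_dvd_coeff_sumLogDeriv_add p hq (hB k)) n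
  rwa [Ideal.mem_span_singleton, coeff_map, coeff_map, Polynomial.coeff_coe] at hmem

end Descent

section Limit

open Filter Topology

open scoped PowerSeries.WithPiTopology

variable (p : ℕ) [hp : Fact p.Prime]

theorem exists_mem_newtonIdeal_of_tendsto {c N K : ℕ} {b : ℚ_[p]⟦X⟧} {b' : ℕ → ℚ_[p]⟦X⟧}
    (hb' : ∀ n, ∃ y ∈ newtonIdeal ℤ_[p] c N K, map (algebraMap ℤ_[p] ℚ_[p]) y = b' n)
    (hlim : Tendsto b' atTop (𝓝 b)) :
    ∃ y ∈ newtonIdeal ℤ_[p] c N K, map (algebraMap ℤ_[p] ℚ_[p]) y = b := by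
  refine exists_mem_newtonIdeal_map_eq _ fun j => ?_
  have hcont : Continuous fun y : ℤ_[p] =>
      algebraMap ℤ_[p] ℚ_[p] ((c : ℤ_[p]) ^ ((K - j) ⌈/⌉ N) * y) :=
    continuous_subtype_val.comp (continuous_const_mul _)
  have hlim_j := (WithPiTopology.tendsto_iff_coeff_tendsto _ _ _ _).1 hlim j
  refine (isCompact_range hcont).isClosed.mem_of_tendsto hlim_j (.of_forall fun n => ?_)
  obtain ⟨y, hy, hyb⟩ := hb' n
  obtain ⟨t, ht⟩ := hy j
  exact ⟨t, by rw [← hyb, coeff_map, ht]⟩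

theorem tendsto_wittTrace {K : Type*} [Field K] [CharP K p] {z : WittVector p K}
    {z' : ℕ → WittVector p K} (h : ∀ n, (p : WittVector p K) ^ n ∣ z - z' n) :
    Tendsto (fun n => wittTrace p K (z' n)) atTop (𝓝 (wittTrace p K z)) := by
  let : Algebra ℤ_[p] (WittVector p K) := (padicIntToWitt p K).toAlgebra
  choose w hw using h
  have htrace (n : ℕ) :
      wittTrace p K (z' n) = wittTrace p K z - (p : ℤ_[p]) ^ n * wittTrace p K (w n) := by
    have hz' : z' n = z - (p : ℤ_[p]) ^ n • w n := by
      rw [Algebra.smul_def, map_pow, map_natCast, ← hw, sub_sub_cancel]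
    rw [hz', wittTrace, wittTrace, wittTrace, map_sub, map_smul, smul_eq_mul]
  have hp1 : ‖(p : ℤ_[p])‖ < 1 := PadicInt.norm_natCast_lt_one_iff.2 dvd_rfl
  have hzero : Tendsto (fun n => (p : ℤ_[p]) ^ n * wittTrace p K (w n)) atTop (𝓝 0) := by
    refine squeeze_zero_norm (fun n => ?_)
      (tendsto_pow_atTop_nhds_zero_of_lt_one (norm_nonneg (p : ℤ_[p])) hp1)
    rw [norm_mul, norm_pow]
    exact mul_le_of_le_one_right (by positivity) (PadicInt.norm_le_one _)
  simpa only [htrace, sub_zero] using hzero.const_sub (wittTrace p K z)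

variable {F : Type*} [Field F] {f : ℕ → Polynomial F}

theorem partialHat_eq_sum_monomial (hf : BddAbove (Set.range fun i => (f i).natDegree)) (l : ℕ) :
    partialHat p f l = ∑ u ∈ Finset.range (maxDegree f + 1), Polynomial.monomial u
      (∑ i ∈ Finset.range l, (p : WittVector p F) ^ i *
        WittVector.teichmuller p ((f i).coeff u)) := by
  simp only [map_sum]
  rw [Finset.sum_comm, partialHat, termIndices, Finset.sum_sigma]
  refine Finset.sum_congr rfl fun i _ => Finset.sum_subset
    (Finset.range_mono (Nat.succ_le_succ (le_ciSup hf i))) fun u _ hu => ?_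
  rw [Polynomial.coeff_eq_zero_of_natDegree_lt (by simpa using hu), WittVector.teichmuller_zero,
    mul_zero, map_zero]

variable [CharP F p]

theorem pow_dvd_eval₂_fHat_sub_partialHat [PerfectRing F p]
    (hf : BddAbove (Set.range fun i => (f i).natDegree)) {K : Type*} [Field K]
    (σ : F →+* K) (x : WittVector p K) (l : ℕ) :
    (p : WittVector p K) ^ l ∣ (fHat p f).eval₂ (WittVector.map σ) x -
      (partialHat p f l).eval₂ (WittVector.map σ) x := by
  rw [partialHat_eq_sum_monomial p hf, fHat, Polynomial.eval₂_finsetSum,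
    Polynomial.eval₂_finsetSum, ← Finset.sum_sub_distrib]
  refine Finset.dvd_sum fun u _ => ?_
  rw [Polynomial.eval₂_monomial, Polynomial.eval₂_monomial, ← sub_mul, ← map_sub]
  refine Dvd.dvd.mul_right ?_ _
  simpa only [map_pow, map_natCast] using map_dvd (WittVector.map σ)
    (pow_dvd_teichmullerSeries_sub_sum p (fun i => (f i).coeff u) l)

theorem tendsto_polyExpSum [PerfectRing F p]
    (hf : BddAbove (Set.range fun i => (f i).natDegree)) {K : Type*} [Field K] [CharP K p]
    (σ : F →+* K) :
    Tendsto (fun l => polyExpSum p σ (partialHat p f l)) atTop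
      (𝓝 (polyExpSum p σ (fHat p f))) := by
  refine tendsto_finsetSum _ fun x _ => ?_
  rw [WithPiTopology.tendsto_iff_coeff_tendsto]
  intro j
  simp only [binomialSeries_coeff, smul_eq_mul, mul_one]
  exact ((PadicInt.continuous_choose j).tendsto _).comp
    (tendsto_wittTrace p fun l => pow_dvd_eval₂_fHat_sub_partialHat p hf σ x l)

theorem tendsto_coeff_sumLogDeriv (q : ℕ) {S : ℕ → ℤ_[p]⟦X⟧} {S' : ℕ → ℕ → ℤ_[p]⟦X⟧}
    (hS : ∀ k, Tendsto (fun l => S' l k) atTop (𝓝 (S k))) (k : ℕ) :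
    Tendsto (fun l => coeff k (sumLogDeriv p q (S' l))) atTop
      (𝓝 (coeff k (sumLogDeriv p q S))) := by
  rw [WithPiTopology.tendsto_iff_coeff_tendsto]
  intro j
  simp only [sumLogDeriv, coeff_mk, map_neg, coeff_smul, coeff_map, smul_eq_mul]
  have hj := (WithPiTopology.tendsto_iff_coeff_tendsto _ _ _ _).1 (hS k) j
  exact (((continuous_subtype_val.tendsto _).comp hj).const_mul _).neg

end Limit

section CharSeries

open scoped PowerSeries.WithPiTopology

variable (p : ℕ) [hp : Fact p.Prime] {F : Type*} [Field F] [Finite F] [CharP F p]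

/-- The exponential sums of `g` over the extensions of `F`, that over the extension of degree
`k + 1` having index `k`. -/
noncomputable def extensionExpSum (g : Polynomial (WittVector p F)) (k : ℕ) : ℤ_[p]⟦X⟧ :=
  polyExpSum p (algebraMap F (FiniteField.Extension F p (k + 1))) g

theorem extensionExpSum_fHat (f : ℕ → Polynomial F) (k : ℕ) :
    extensionExpSum p (fHat p f) k = expSum p f (k + 1) := by
  rw [expSum, extensionExpSum, polyExpSum, FiniteField.natCard_extension]

theorem constantCoeff_logCharSeries (f : ℕ → Polynomial F) :
    constantCoeff (logCharSeries p f) = 0 := by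
  rw [← coeff_zero_eq_constantCoeff_apply, logCharSeries, coeff_mk]

theorem derivative_logCharSeries (f : ℕ → Polynomial F) :
    d⁄dX _ (logCharSeries p f) =
      sumLogDeriv p (Nat.card F) (extensionExpSum p (fHat p f)) := by
  ext1 k
  simp only [coeff_derivative, logCharSeries, coeff_mk, sumLogDeriv, extensionExpSum_fHat]
  rw [neg_mul, ← Nat.cast_succ, mul_comm, ← nsmul_eq_mul, ← Nat.cast_smul_eq_nsmul ℚ_[p],
    mul_comm (_ - 1), mul_inv, mul_smul, smul_inv_smul₀ (Nat.cast_ne_zero.2 k.succ_ne_zero)]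

theorem charSeries_eq_exp_subst (f : ℕ → Polynomial F) :
    charSeries p f = (exp ℚ_[p]⟦X⟧).subst (logCharSeries p f) := by
  have hs : HasSubst (logCharSeries p f) :=
    .of_constantCoeff_zero' (constantCoeff_logCharSeries p f)
  ext1 n
  rw [charSeries, coeff_subst' hs, coeff_subst' hs]
  refine finsum_congr fun d => ?_
  rw [coeff_exp, coeff_exp]
  exact (algebraMap_smul ℚ_[p]⟦X⟧ _ _).symm

theorem hasLogDeriv_charSeries (f : ℕ → Polynomial F) :
    HasLogDeriv (charSeries p f)
      (sumLogDeriv p (Nat.card F) (extensionExpSum p (fHat p f))) := by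
  rw [charSeries_eq_exp_subst, ← derivative_logCharSeries]
  exact .exp_subst (.of_constantCoeff_zero' (constantCoeff_logCharSeries p f))

theorem constantCoeff_charSeries (f : ℕ → Polynomial F) : constantCoeff (charSeries p f) = 1 := by
  rw [charSeries_eq_exp_subst,
    constantCoeff_subst_of_constantCoeff_eq_zero (constantCoeff_logCharSeries p f),
    constantCoeff_exp]

theorem exists_mem_newtonIdeal_map_eq_coeff_of_partialHat {a : ℕ} (hF : Nat.card F = p ^ a)
    {f : ℕ → Polynomial F} {D : ℕ} (hD : 0 < D) (hfD : ∀ i, (f i).natDegree ≤ D) {c N : ℕ} {δ : ℝ}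
    (hδ : 0 < δ) {e : ℕ → ℕ} (he : ∀ i, levelParam p ℤ_[p] i ∈ newtonIdeal ℤ_[p] c N (e i))
    (hd : ∀ i, ((f i).natDegree : ℝ) ≤ δ * e i) (l : ℕ) {g : ℚ_[p]⟦X⟧⟦X⟧}
    (hg0 : constantCoeff g = 1)
    (hg : HasLogDeriv g (sumLogDeriv p (Nat.card F) (extensionExpSum p (partialHat p f l))))
    (n : ℕ) :
    ∃ y ∈ newtonIdeal ℤ_[p] c N ⌈((a : ℝ) * ((p : ℝ) - 1) * n * ((n : ℝ) - 1)) / (2 * δ)⌉₊,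
      map (algebraMap ℤ_[p] ℚ_[p]) y = coeff n g := by
  have ha : 0 < a := Nat.pos_of_ne_zero fun h => Finite.one_lt_card.ne' (by rw [hF, h, pow_zero])
  refine exists_mem_newtonIdeal_map_eq _ fun j => ?_
  let B := matProd (frobMatrix p f l (D * (j + 1))) a
  have htrace (k : ℕ) :
      X ^ (j + 1) ∣ ((Nat.card F ^ (k + 1) - 1 : ℕ) : (WittVector p F)⟦X⟧) * (B ^ (k + 1)).trace -
        map (padicIntToWitt p F) (extensionExpSum p (partialHat p f l) k) := by
    rw [hF, ← pow_mul]
    refine X_pow_dvd_trace_sub_polyExpSum p f _ hF ?_ hD hfD l (j + 1)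
    rw [FiniteField.natCard_extension, hF, ← pow_mul]
  have hcoeff := X_pow_dvd_iff.1
    (X_pow_dvd_coeff_sub_coeff_charpolyRev p Finite.one_lt_card hg0 hg htrace n) j j.lt_succ_self
  rw [map_sub, sub_eq_zero, coeff_map, coeff_map] at hcoeff
  have hmem := coeff_charpolyRev_matProd_mem_newtonIdeal (A := frobMatrix p f l (D * (j + 1)))
    Fin.val_injective hp.out.one_lt.le hδ (fun i => dworkMatrix_truncDegree_mem_newtonIdeal
      hp.out.ne_zero (conjSplitting_mem_weightMonoid p f hδ he hd l i)) ha n j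
  rw [← Nat.cast_pow] at hmem ⊢
  exact exists_algebraMap_natCast_mul_eq p hcoeff hmem

theorem exists_mem_newtonIdeal_map_eq_coeff_charSeries {a : ℕ} (hF : Nat.card F = p ^ a)
    {f : ℕ → Polynomial F} (hf : BddAbove (Set.range fun i => (f i).natDegree))
    {c N : ℕ} {δ : ℝ} (hδ : 0 < δ) {e : ℕ → ℕ}
    (he : ∀ i, levelParam p ℤ_[p] i ∈ newtonIdeal ℤ_[p] c N (e i))
    (hd : ∀ i, ((f i).natDegree : ℝ) ≤ δ * e i) (n : ℕ) :
    ∃ y ∈ newtonIdeal ℤ_[p] c N ⌈((a : ℝ) * ((p : ℝ) - 1) * n * ((n : ℝ) - 1)) / (2 * δ)⌉₊,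
      map (algebraMap ℤ_[p] ℚ_[p]) y = coeff n (charSeries p f) := by
  have hfD (i : ℕ) : (f i).natDegree ≤ maxDegree f + 1 := (le_ciSup hf i).trans (Nat.le_succ _)
  choose g hg0 hg using fun l => exists_hasLogDeriv
    (sumLogDeriv p (Nat.card F) (extensionExpSum p (partialHat p f l)))
  refine exists_mem_newtonIdeal_of_tendsto p
    (fun l => exists_mem_newtonIdeal_map_eq_coeff_of_partialHat p hF (Nat.succ_pos _) hfD hδ he hd
      l (hg0 l) (hg l) n)
    ((hasLogDeriv_charSeries p f).tendsto_coeff hg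
      (fun l => (hg0 l).trans (constantCoeff_charSeries p f).symm)
      (tendsto_coeff_sumLogDeriv p _ fun k => tendsto_polyExpSum p hf _) n)

end CharSeries

section Order

theorem le_adicOrder {A : Type*} [CommRing A] {I : Ideal A} {x : A} {m : ℕ} (h : x ∈ I ^ m) :
    (m : ℕ∞) ≤ adicOrder I x :=
  le_iSup₂_of_le m h le_rfl

theorem mem_span_C_X_pow {A : Type*} [CommRing A] {ϖ : A} {K : ℕ} {b : A⟦X⟧}
    (hb : ∀ j < K, ϖ ^ (K - j) ∣ coeff j b) : b ∈ Ideal.span {C ϖ, X} ^ K := by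
  have hϖ : C ϖ ∈ (Ideal.span {C ϖ, X} : Ideal A⟦X⟧) := Ideal.subset_span (by simp)
  have hX : (X : A⟦X⟧) ∈ (Ideal.span {C ϖ, X} : Ideal A⟦X⟧) := Ideal.subset_span (by simp)
  obtain ⟨t, ht⟩ : X ^ K ∣ b - (trunc K b : A⟦X⟧) := X_pow_dvd_iff.2 fun j hj => by
    rw [map_sub, Polynomial.coeff_coe, coeff_trunc, if_pos hj, sub_self]
  rw [← sub_add_cancel b (trunc K b : A⟦X⟧), ht]
  refine Ideal.add_mem _ (Ideal.mul_mem_right _ _ (Ideal.pow_mem_pow hX K)) ?_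
  rw [trunc_apply, ← Polynomial.coeToPowerSeries.ringHom_apply, map_sum]
  refine Ideal.sum_mem _ fun j hj => ?_
  have hjK : j < K := by simpa using hj
  obtain ⟨u, hu⟩ := hb j hjK
  have hterm := Ideal.mul_mem_mul
    (Ideal.mul_mem_right (C u) _ (Ideal.pow_mem_pow hϖ (K - j))) (Ideal.pow_mem_pow hX j)
  rw [← pow_add, Nat.sub_add_cancel hjK.le] at hterm
  simpa [hu, ← Polynomial.C_mul_X_pow_eq_monomial] using hterm

variable (p : ℕ) [hp : Fact p.Prime]

theorem algebraMap_padicIntRoot_p (N : ℕ) :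
    algebraMap ℤ_[p] (PadicIntRoot p N) p =
      AdjoinRoot.root (Polynomial.X ^ N - Polynomial.C (p : ℤ_[p])) ^ N := by
  have h := AdjoinRoot.eval₂_root (Polynomial.X ^ N - Polynomial.C (p : ℤ_[p]))
  rw [Polynomial.eval₂_sub, Polynomial.eval₂_X_pow, Polynomial.eval₂_C, sub_eq_zero] at h
  exact h.symm

theorem le_ordR_one {K : ℕ} {b : ℤ_[p]⟦X⟧} (hb : b ∈ newtonIdeal ℤ_[p] 0 1 K) :
    (K : ℕ∞) ≤ ordR p 1 b := by
  rw [ordR, if_pos rfl]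
  refine le_adicOrder ?_
  rw [Ideal.span_singleton_pow, Ideal.mem_span_singleton, X_pow_dvd_iff]
  intro j hj
  simpa [(Nat.sub_pos_of_lt hj).ne'] using hb j

theorem le_ordR_add_two (m : ℕ) {K : ℕ} {b : ℤ_[p]⟦X⟧}
    (hb : b ∈ newtonIdeal ℤ_[p] p (p ^ m * (p - 1)) K) : (K : ℕ∞) ≤ ordR p (m + 2) b := by
  rw [ordR, if_neg (by omega), Nat.add_sub_cancel]
  have hN : 0 < p ^ m * (p - 1) :=
    Nat.mul_pos (pow_pos hp.out.pos _) (Nat.sub_pos_of_lt hp.out.one_lt)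
  refine le_adicOrder (mem_span_C_X_pow fun j _ => ?_)
  have hdvd := map_dvd (algebraMap ℤ_[p] (PadicIntRoot p (p ^ m * (p - 1)))) (hb j)
  rw [map_pow, algebraMap_padicIntRoot_p, ← pow_mul] at hdvd
  rw [coeff_map]
  exact (pow_dvd_pow _ ((ceilDiv_le_iff_le_mul hN).1 le_rfl)).trans hdvd

theorem exists_levelParam_mem_newtonIdeal_le_ordR (m : ℕ) :
    ∃ c N, (∀ i, levelParam p ℤ_[p] i ∈ newtonIdeal ℤ_[p] c N (p ^ min i m)) ∧
      ∀ (K : ℕ) (b : ℤ_[p]⟦X⟧), b ∈ newtonIdeal ℤ_[p] c N K → (K : ℕ∞) ≤ ordR p (m + 1) b := by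
  rcases m with _ | m
  · refine ⟨0, 1, fun i => ?_, fun K b => le_ordR_one p⟩
    simpa using mem_newtonIdeal_one (constantCoeff_levelParam i)
  · exact ⟨p, p ^ m * (p - 1), levelParam_mem_newtonIdeal m, fun K b => le_ordR_add_two p m⟩

end Order

section Degrees

variable (p : ℕ) [hp : Fact p.Prime] {F : Type*} [Field F] {f : ℕ → Polynomial F}

theorem bddAbove_range_natDegree_div (hf : BddAbove (Set.range fun i => (f i).natDegree)) :
    BddAbove (Set.range fun i : ℕ => ((f i).natDegree : ℝ) / (p : ℝ) ^ i) := by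
  obtain ⟨D, hD⟩ := hf
  refine ⟨D, Set.forall_mem_range.2 fun i => ?_⟩
  have hpi : (1 : ℝ) ≤ (p : ℝ) ^ i := one_le_pow₀ (Nat.one_le_cast.2 hp.out.one_lt.le)
  exact (div_le_self (Nat.cast_nonneg _) hpi).trans (Nat.cast_le.2 (hD ⟨i, rfl⟩))

theorem natDegree_le_delta_mul_pow (hf : BddAbove (Set.range fun i => (f i).natDegree)) (i : ℕ) :
    ((f i).natDegree : ℝ) ≤ delta p f * (p : ℝ) ^ i := by
  rw [← div_le_iff₀ (pow_pos (Nat.cast_pos.2 hp.out.pos) i)]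
  exact le_ciSup (bddAbove_range_natDegree_div p hf) i

theorem delta_pos (hf₀ : ∃ i, 0 < (f i).natDegree)
    (hf : BddAbove (Set.range fun i => (f i).natDegree)) : 0 < delta p f := by
  obtain ⟨i, hi⟩ := hf₀
  refine pos_of_mul_pos_left ((Nat.cast_pos.2 hi).trans_le (natDegree_le_delta_mul_pow p hf i)) ?_
  exact pow_nonneg (Nat.cast_nonneg p) i

theorem natDegree_eq_maxDegree (hf : BddAbove (Set.range fun i => (f i).natDegree)) {m : ℕ}
    (hm : mTilde f = 1 + m) : (f m).natDegree = maxDegree f :=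
  Nat.add_left_cancel hm ▸
    Nat.sInf_mem (s := {i | (f i).natDegree = maxDegree f}) (Nat.sSup_mem (Set.range_nonempty _) hf)

theorem natDegree_le_delta_mul_pow_min (hf : BddAbove (Set.range fun i => (f i).natDegree)) {m : ℕ}
    (hm : mTilde f = 1 + m) (i : ℕ) :
    ((f i).natDegree : ℝ) ≤ delta p f * (p ^ min i m : ℕ) := by
  push_cast
  rcases le_total i m with h | h
  · rw [min_eq_left h]
    exact natDegree_le_delta_mul_pow p hf i
  · rw [min_eq_right h]
    refine le_trans ?_ (natDegree_le_delta_mul_pow p hf m)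
    rw [natDegree_eq_maxDegree hf hm]
    exact Nat.cast_le.2 (le_ciSup hf i)

end Degrees

end WittTower

theorem theorem6_general (p : ℕ) [Fact p.Prime] (a : ℕ)
    (F : Type*) [Field F] [Finite F] [CharP F p] (hF : Nat.card F = p ^ a)
    (f : ℕ → Polynomial F) (hf₀ : ∃ i, 0 < (f i).natDegree)
    (hf : BddAbove (Set.range fun i => (f i).natDegree)) :
    ∃ C : ℤ_[p]⟦X⟧⟦X⟧,
      PowerSeries.map (PowerSeries.map (algebraMap ℤ_[p] ℚ_[p])) C = WittTower.charSeries p f ∧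
      ∀ n : ℕ,
        ENNReal.ofReal (((a : ℝ) * ((p : ℝ) - 1) * (n : ℝ) * ((n : ℝ) - 1)) /
            (2 * WittTower.delta p f)) ≤
          ((WittTower.ordR p (WittTower.mTilde f) (PowerSeries.coeff n C) : ℕ∞) : ℝ≥0∞) := by
  obtain ⟨m, hm⟩ : ∃ m, WittTower.mTilde f = 1 + m := ⟨_, rfl⟩
  obtain ⟨c, N, hparam, hord⟩ := WittTower.exists_levelParam_mem_newtonIdeal_le_ordR p m
  choose b hb hbC using WittTower.exists_mem_newtonIdeal_map_eq_coeff_charSeries p hF hf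
    (WittTower.delta_pos p hf₀ hf) hparam (WittTower.natDegree_le_delta_mul_pow_min p hf hm)
  refine ⟨PowerSeries.mk b, PowerSeries.ext fun n => ?_, fun n => ?_⟩
  · rw [PowerSeries.coeff_map, PowerSeries.coeff_mk, hbC]
  · rw [PowerSeries.coeff_mk, hm, add_comm 1 m]
    refine (ENNReal.ofReal_le_ofReal (Nat.le_ceil _)).trans ?_
    rw [ENNReal.ofReal_natCast]
    exact ENat.toENNReal_le.2 (hord _ _ (hb n))

theorem theorem6 (p : ℕ) [Fact p.Prime] (a : ℕ) (ha : 0 < a)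
    (F : Type*) [Field F] [Finite F] [CharP F p] (hF : Nat.card F = p ^ a)
    (f : ℕ → Polynomial F) (hf₀ : 0 < (f 0).natDegree)
    (hf : BddAbove (Set.range fun i => (f i).natDegree)) :
    ∃ C : ℤ_[p]⟦X⟧⟦X⟧,
      PowerSeries.map (PowerSeries.map (algebraMap ℤ_[p] ℚ_[p])) C = WittTower.charSeries p f ∧
      ∀ n : ℕ,
        ENNReal.ofReal (((a : ℝ) * ((p : ℝ) - 1) * (n : ℝ) * ((n : ℝ) - 1)) /
            (2 * WittTower.delta p f)) ≤
          ((WittTower.ordR p (WittTower.mTilde f) (PowerSeries.coeff n C) : ℕ∞) : ℝ≥0∞) :=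
  theorem6_general p a F hF f ⟨0, hf₀⟩ hf
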